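/- Let $1<p<\infty$. There is a constant $c_p>0$, depending only on $p$, such that the following holds. A weight is a measurable function $w:\mathbb R\to[0,\infty]$ that is finite almost everywhere. Put $\sigma=w^{-\frac1{p-1}}$ (equal to $\infty$ where $w=0$), and for measurable $f$ let $$M^+f(x)=\sup_{h>0}\frac1h\int_x^{x+h}|f(y)|\,dy,\qquad \|f\|_{L^p(w)}=\Big(\int_{\mathbb R}|f|^p\,w\Big)^{1/p}\in[0,\infty],$$ $$[w]_{A_p^+}=\sup_{a<b<c}\frac1{c-a}\int_a^b w\left(\frac1{c-a}\int_b^c w^{-\frac1{p-1}}\right)^{p-1},\qquad [\sigma]_{A_\infty^-}=\sup_{a<b}\frac1{\sigma(a,b)}\int_a^b M^+(\sigma\chi_{(a,b)}),$$ where $\sigma(a,b)=\int_a^b\sigma$, the convention $0\cdot\infty=0$ is used, and the last supremum is over the intervals with $0<\sigma(a,b)<\infty$ (a supremum over no intervals being $0$). If $w$ is a weight with $[w]_{A_p^+}<\infty$ (that is, $w\in A_p^+$), then for every measurable $f:\mathbb R\to\mathbb R$ $$\|M^+f\|_{L^p(w)}\le c_p\,[w]_{A_p^+}^{\frac1{p-1}}\,\|f\|_{L^p(w)}$$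 and $$\|M^+f\|_{L^p(w)}\le c_p\,\big([w]_{A_p^+}[\sigma]_{A_\infty^-}\big)^{\frac1p}\,\|f\|_{L^p(w)}.$$ -/

import Mathlib

open MeasureTheory Set
open scoped ENNReal NNReal

noncomputable section

/-- The forward one-sided maximal operator
`M⁺f(x) = sup_{h > 0} (1/h) ∫_x^{x+h} |f|`, with values in `[0, ∞]`.
It applies to real functions and to `[0, ∞]`-valued ones (for which `‖t‖ₑ = t`). -/
def maximalPlus {E : Type*} [ENorm E] (f : ℝ → E) (x : ℝ) : ℝ≥0∞ :=
  ⨆ (h : ℝ) (_ : 0 < h), (ENNReal.ofReal h)⁻¹ * ∫⁻ y in Ioo x (x + h), ‖f y‖ₑ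

/-- A weight on the real line: a measurable, nonnegative, almost everywhere finite function.
It may vanish on a set of positive measure. -/
structure IsWeight (w : ℝ → ℝ≥0∞) : Prop where
  aemeasurable : AEMeasurable w volume
  ae_lt_top : ∀ᵐ x, w x < ∞

/-- The dual weight `σ = w^{-1/(p-1)}`, which is `∞` where `w = 0`. -/
def dualWeight (p : ℝ) (w : ℝ → ℝ≥0∞) (x : ℝ) : ℝ≥0∞ :=
  w x ^ (-(1 / (p - 1)))

/-- The constant `[w]_{A_p^+}`, the supremum over `a < b < c` of
`(1/(c-a)) ∫_a^b w * ((1/(c-a)) ∫_b^c w^{-1/(p-1)})^{p-1}`, with `0 * ∞ = 0`. -/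
def apPlusConst (p : ℝ) (w : ℝ → ℝ≥0∞) : ℝ≥0∞ :=
  ⨆ (a : ℝ) (b : ℝ) (c : ℝ) (_ : a < b) (_ : b < c),
    ((ENNReal.ofReal (c - a))⁻¹ * ∫⁻ x in Ioo a b, w x) *
      ((ENNReal.ofReal (c - a))⁻¹ * ∫⁻ x in Ioo b c, dualWeight p w x) ^ (p - 1)

/-- The class `A_p^+`: weights with finite `A_p^+` constant. -/
def MemApPlus (p : ℝ) (w : ℝ → ℝ≥0∞) : Prop :=
  IsWeight w ∧ apPlusConst p w < ∞

/-- The constant `[v]_{A_∞^-}`, the supremum over `a < b` of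
`(1/v(a,b)) ∫_a^b M⁺(v χ_{(a,b)})`.
Intervals with `v(a,b) = 0` or `v(a,b) = ∞` contribute `0`. -/
def aInftyMinusConst (v : ℝ → ℝ≥0∞) : ℝ≥0∞ :=
  ⨆ (a : ℝ) (b : ℝ) (_ : a < b),
    (∫⁻ x in Ioo a b, maximalPlus ((Ioo a b).indicator v) x) / ∫⁻ x in Ioo a b, v x

/-- The norm `‖f‖_{L^p(w)} = (∫ |f|^p w)^{1/p}`, with value `∞` outside `L^p(w)`. -/
def weightedNorm {E : Type*} [ENorm E] (p : ℝ) (w : ℝ → ℝ≥0∞) (f : ℝ → E) : ℝ≥0∞ :=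
  (∫⁻ x, ‖f x‖ₑ ^ p * w x) ^ (1 / p)

end

/-! Write `K` for the constant of `w` and `σ` for the dual weight. Let `F` be the forward maximal
function of `σ` restricted to an interval `J`. By the rising sun lemma each component `(a, b)` of
`{F > l}` in `J` has `σ(x, b) ≥ l (b - x)` for all its points `x`. Cutting `(a, b)` into pieces that
halve towards `b` and applying the `A_p^+` condition to each piece gives `w(a, b) l^(p-1) ≤ 2^p K (b
- a)`. Summing over components and integrating in `l` yields `∫_J F^p w ≤ p 2^p K ∫_J F`.

This estimate is used twice. Bounding `∫_J F` by the `A_∞^-` constant gives a testing inequality for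
`σ`. Hölder's inequality instead gives `[σ] ≤ (p 2^p K)^(1/(p-1))`, which reduces the first bound of
the theorem to the second.

Testing implies the strong bound by a Sawyer-type argument (`setLIntegral_fwdMax_rpow_le`). An
average of `|f|` over `(x, y)` is its `σ`-average times the mean of `σ`. Sorting by the dyadic size
`2^m` of the `σ`-average bounds `M⁺f` by `2^(m+1)` times a forward maximal function of `σ` on a
component of the level set `U_m`. Testing turns this into `∑ 2^(mp) σ(U_m)`, which a weak type
inequality for `σ`-averages sums to `∫ |f|^p w`. Where `σ` has infinite mass on a bounded interval,
`w` vanishes to the left. -/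

/-! ### Forward maximal functions of measures -/

/-- The forward maximal function of a measure on the line. -/
noncomputable def fwdMax (ν : Measure ℝ) (x : ℝ) : ℝ≥0∞ :=
  ⨆ (h : ℝ) (_ : 0 < h), (ENNReal.ofReal h)⁻¹ * ν (Ioo x (x + h))

lemma maximalPlus_eq_fwdMax {E : Type*} [ENorm E] (f : ℝ → E) :
    maximalPlus f = fwdMax (volume.withDensity fun y => ‖f y‖ₑ) := by
  funext x
  simp only [maximalPlus, fwdMax, withDensity_apply _ measurableSet_Ioo]

lemma maximalPlus_indicator (v : ℝ → ℝ≥0∞) {s : Set ℝ} (hs : MeasurableSet s) :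
    maximalPlus (s.indicator v) = fwdMax ((volume.withDensity v).restrict s) := by
  rw [maximalPlus_eq_fwdMax]
  simp only [enorm_eq_self]
  rw [withDensity_indicator hs, restrict_withDensity hs]

lemma le_fwdMax (ν : Measure ℝ) {x y : ℝ} (hxy : x < y) :
    (ENNReal.ofReal (y - x))⁻¹ * ν (Ioo x y) ≤ fwdMax ν x := by
  refine le_iSup₂_of_le (y - x) (sub_pos.2 hxy) ?_
  rw [add_sub_cancel]

lemma lt_fwdMax_iff {ν : Measure ℝ} {x : ℝ} {l : ℝ≥0∞} :
    l < fwdMax ν x ↔ ∃ y, x < y ∧ l < (ENNReal.ofReal (y - x))⁻¹ * ν (Ioo x y) := by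
  constructor
  · intro h
    simp only [fwdMax, lt_iSup_iff] at h
    obtain ⟨h, hh, hl⟩ := h
    exact ⟨x + h, by linarith, by simpa using hl⟩
  · rintro ⟨y, hxy, hl⟩
    exact hl.trans_le (le_fwdMax ν hxy)

/-- For fixed `h`, intervals `(y, y + h)` with `y` near `x` contain a slightly shrunken `(x, x +
h)`, whose mass is almost full by continuity from below. No finiteness of `ν` enters. -/
lemma lowerSemicontinuous_fwdMax (ν : Measure ℝ) : LowerSemicontinuous (fwdMax ν) := by
  refine lowerSemicontinuous_iSup fun h => lowerSemicontinuous_iSup fun hh => ?_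
  intro x r hr
  have hc : (ENNReal.ofReal h)⁻¹ ≠ ∞ := by simpa using hh
  let e : ℕ → ℝ := fun n => 1 / ((n : ℝ) + 1)
  have he : ∀ n, 0 < e n := fun n => by positivity
  have hmono : Monotone fun n => Ioo (x + e n) (x + h - e n) := by
    intro m n hmn
    have : e n ≤ e m := one_div_le_one_div_of_le (by positivity) (by gcongr)
    exact Ioo_subset_Ioo (by linarith) (by linarith)
  have hU : ⋃ n, Ioo (x + e n) (x + h - e n) = Ioo x (x + h) := by
    ext y
    simp only [mem_iUnion, mem_Ioo]
    constructor
    · rintro ⟨n, h1, h2⟩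
      have := he n
      constructor <;> linarith
    · rintro ⟨h1, h2⟩
      obtain ⟨n, hn⟩ := exists_nat_one_div_lt (show 0 < min (y - x) (x + h - y) from
        lt_min (by linarith) (by linarith))
      have h3 := hn.trans_le (min_le_left _ _)
      have h4 := hn.trans_le (min_le_right _ _)
      exact ⟨n, by simp only [e]; linarith, by simp only [e]; linarith⟩
  have ht := tendsto_measure_iUnion_atTop (μ := ν) hmono
  rw [hU] at ht
  have ht' := ENNReal.Tendsto.const_mul ht (Or.inr hc)
  obtain ⟨n, hn⟩ := (ht'.eventually (lt_mem_nhds hr)).exists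
  filter_upwards [Ioo_mem_nhds (show x - e n < x by linarith [he n])
    (show x < x + e n by linarith [he n])] with y hy
  refine hn.trans_le ?_
  simp only [Function.comp]
  gcongr
  exacts [by linarith [hy.2], by linarith [hy.1]]

lemma measurable_fwdMax (ν : Measure ℝ) : Measurable (fwdMax ν) :=
  (lowerSemicontinuous_fwdMax ν).measurable

/-! ### Components of open sets and a covering lemma -/

/-- The pairs of endpoints of the components of a set of reals. -/
def gaps (U : Set ℝ) : Set (ℝ × ℝ) :=
  {q | q.1 < q.2 ∧ Ioo q.1 q.2 ⊆ U ∧ q.1 ∉ U ∧ q.2 ∉ U}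

lemma gaps_pairwiseDisjoint (U : Set ℝ) :
    (gaps U).PairwiseDisjoint fun q => Ioo q.1 q.2 := by
  rintro ⟨a, b⟩ ⟨-, h2, h3, h4⟩ ⟨c, d⟩ ⟨-, k2, k3, k4⟩ hne
  refine Set.disjoint_left.2 fun z hz hz' => hne ?_
  simp only [mem_Ioo] at *
  have e1 : a ≤ c := by
    by_contra! h
    exact h3 (k2 ⟨h, by linarith⟩)
  have e2 : c ≤ a := by
    by_contra! h
    exact k3 (h2 ⟨h, by linarith⟩)
  have e3 : d ≤ b := by
    by_contra! h
    exact h4 (k2 ⟨by linarith, h⟩)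
  have e4 : b ≤ d := by
    by_contra! h
    exact k4 (h2 ⟨by linarith, h⟩)
  rw [le_antisymm e1 e2, le_antisymm e3 e4]

lemma gaps_countable (U : Set ℝ) : (gaps U).Countable :=
  (gaps_pairwiseDisjoint U).countable_of_isOpen (fun _ _ => isOpen_Ioo)
    fun _ hq => nonempty_Ioo.2 hq.1

/-- The component of `x` ends at the nearest points of the complement on either side; boundedness of
`U` makes these exist. -/
lemma biUnion_gaps {U : Set ℝ} (hU : IsOpen U) {α β : ℝ} (hsub : U ⊆ Ioo α β) :
    ⋃ q ∈ gaps U, Ioo q.1 q.2 = U := by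
  refine subset_antisymm (iUnion₂_subset fun q hq => hq.2.1) fun x hx => ?_
  have hxD := hsub hx
  have hA : IsClosed (Uᶜ ∩ Iic x) := hU.isClosed_compl.inter isClosed_Iic
  have hB : IsClosed (Uᶜ ∩ Ici x) := hU.isClosed_compl.inter isClosed_Ici
  have hAn : (Uᶜ ∩ Iic x).Nonempty := ⟨α, fun h => (hsub h).1.false, hxD.1.le⟩
  have hBn : (Uᶜ ∩ Ici x).Nonempty := ⟨β, fun h => (hsub h).2.false, hxD.2.le⟩
  have hAb : BddAbove (Uᶜ ∩ Iic x) := ⟨x, fun y hy => hy.2⟩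
  have hBb : BddBelow (Uᶜ ∩ Ici x) := ⟨x, fun y hy => hy.2⟩
  have ha := hA.csSup_mem hAn hAb
  have hb := hB.csInf_mem hBn hBb
  set a := sSup (Uᶜ ∩ Iic x)
  set b := sInf (Uᶜ ∩ Ici x)
  have hax : a < x := lt_of_le_of_ne ha.2 fun h => ha.1 (h ▸ hx)
  have hxb : x < b := lt_of_le_of_ne hb.2 fun h => hb.1 (h ▸ hx)
  refine mem_iUnion₂.2 ⟨(a, b), ⟨hax.trans hxb, fun y hy => ?_, ha.1, hb.1⟩, hax, hxb⟩
  by_contra hyU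
  rcases le_total y x with h | h
  · exact (le_csSup hAb ⟨hyU, h⟩).not_gt hy.1
  · exact (csInf_le hBb ⟨hyU, h⟩).not_gt hy.2

lemma measure_eq_tsum_gaps (μ : Measure ℝ) {U : Set ℝ} (hU : IsOpen U) {α β : ℝ}
    (hsub : U ⊆ Ioo α β) : μ U = ∑' q : gaps U, μ (Ioo (q : ℝ × ℝ).1 (q : ℝ × ℝ).2) := by
  conv_lhs => rw [← biUnion_gaps hU hsub]
  exact measure_biUnion (gaps_countable U) (gaps_pairwiseDisjoint U)
    fun _ _ => measurableSet_Ioo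

/-- Among three intervals with a common point, one lies in the union of the one reaching furthest
left and the one reaching furthest right, so it can be discarded. -/
lemma exists_subcover_overlap_le_two (s : Finset (ℝ × ℝ)) :
    ∃ t ⊆ s, (⋃ q ∈ s, Ioo q.1 q.2) ⊆ (⋃ q ∈ t, Ioo q.1 q.2) ∧
      ∀ x, (t.filter fun q => x ∈ Ioo q.1 q.2).card ≤ 2 := by
  induction s using Finset.strongInduction with
  | H s ih =>
    by_cases h : ∀ x, (s.filter fun q => x ∈ Ioo q.1 q.2).card ≤ 2
    · exact ⟨s, subset_rfl, subset_rfl, h⟩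
    push Not at h
    obtain ⟨x, hx⟩ := h
    set r := s.filter fun q => x ∈ Ioo q.1 q.2
    have hr : r.Nonempty := Finset.card_pos.1 (by omega)
    obtain ⟨i, hi, hi'⟩ := r.exists_min_image (fun q => q.1) hr
    obtain ⟨j, hj, hj'⟩ := r.exists_max_image (fun q => q.2) hr
    obtain ⟨k, hk, hki, hkj⟩ : ∃ k ∈ r, k ≠ i ∧ k ≠ j := by
      by_contra! hcon
      have : r ⊆ {i, j} := fun k hk => by
        by_cases h : k = i
        · simp [h]
        · simp [hcon k hk h]
      have := (Finset.card_le_card this).trans Finset.card_le_two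
      omega
    have hmem : ∀ q ∈ r, q ∈ s ∧ x ∈ Ioo q.1 q.2 := fun q hq => Finset.mem_filter.1 hq
    obtain ⟨t, hts, htc, ht⟩ := ih (s.erase k) (Finset.erase_ssubset (hmem k hk).1)
    refine ⟨t, hts.trans (Finset.erase_subset _ _), subset_trans ?_ htc, ht⟩
    refine iUnion₂_subset fun q hq y hy => ?_
    by_cases hqk : q = k
    · subst hqk
      rcases le_or_gt y x with h | h
      · refine mem_iUnion₂.2 ⟨i, Finset.mem_erase.2 ⟨hki.symm, (hmem i hi).1⟩,
          (hi' q hk).trans_lt hy.1, h.trans_lt (hmem i hi).2.2⟩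
      · refine mem_iUnion₂.2 ⟨j, Finset.mem_erase.2 ⟨hkj.symm, (hmem j hj).1⟩,
          (hmem j hj).2.1.trans h, hy.2.trans_le (hj' q hk)⟩
    · exact mem_iUnion₂.2 ⟨q, Finset.mem_erase.2 ⟨hqk, hq⟩, hy⟩

lemma sum_measure_Ioo_le_of_overlap (ρ : Measure ℝ) (t : Finset (ℝ × ℝ)) {D : Set ℝ}
    (hD : ∀ q ∈ t, Ioo q.1 q.2 ⊆ D)
    (ht : ∀ x, (t.filter fun q => x ∈ Ioo q.1 q.2).card ≤ 2) :
    ∑ q ∈ t, ρ (Ioo q.1 q.2) ≤ 2 * ρ D := by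
  have h1 : ∀ q ∈ t, ρ (Ioo q.1 q.2) = ∫⁻ x, (Ioo q.1 q.2).indicator 1 x ∂ρ :=
    fun q _ => (lintegral_indicator_one measurableSet_Ioo).symm
  rw [Finset.sum_congr rfl h1, ← lintegral_finsetSum _
    fun q _ => measurable_one.indicator measurableSet_Ioo]
  calc ∫⁻ x, ∑ q ∈ t, (Ioo q.1 q.2).indicator 1 x ∂ρ
      ≤ ∫⁻ x, D.indicator (fun _ => 2) x ∂ρ := by
        refine lintegral_mono fun x => ?_
        by_cases hx : x ∈ D
        · have : ∑ q ∈ t, (Ioo q.1 q.2).indicator (1 : ℝ → ℝ≥0∞) x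
              = ((t.filter fun q => x ∈ Ioo q.1 q.2).card : ℝ≥0∞) := by
            simp only [indicator_apply, Pi.one_apply, Finset.sum_boole]
          simp only [this, indicator_of_mem hx]
          exact_mod_cast ht x
        · have : ∑ q ∈ t, (Ioo q.1 q.2).indicator (1 : ℝ → ℝ≥0∞) x = 0 :=
            Finset.sum_eq_zero fun q hq => indicator_of_notMem (fun h => hx (hD q hq h)) _
          simp [this]
    _ ≤ 2 * ρ D := lintegral_indicator_const_le _ _

/-- Lindelöf and continuity from below reduce to finite families, where a subcover of overlap two
gives the factor 2 for any `ν`, doubling or not. -/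
lemma weakType_biUnion_Ioo (ν ρ : Measure ℝ) (t : ℝ≥0∞) (S : Set (ℝ × ℝ)) {D : Set ℝ}
    (hD : ∀ q ∈ S, Ioo q.1 q.2 ⊆ D) (hS : ∀ q ∈ S, t * ν (Ioo q.1 q.2) ≤ ρ (Ioo q.1 q.2)) :
    t * ν (⋃ q ∈ S, Ioo q.1 q.2) ≤ 2 * ρ D := by
  classical
  obtain ⟨T, hTS, hT, hTU⟩ := TopologicalSpace.isOpen_biUnion_countable S
    (fun q : ℝ × ℝ => Ioo q.1 q.2) fun _ _ => isOpen_Ioo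
  rw [← hTU]
  have : Countable T := hT
  have hU : ⋃ q ∈ T, Ioo q.1 q.2
      = ⋃ F : Finset T, ⋃ q ∈ F.image Subtype.val, Ioo (q : ℝ × ℝ).1 (q : ℝ × ℝ).2 := by
    ext x
    simp only [mem_iUnion]
    constructor
    · rintro ⟨q, hq, hx⟩
      exact ⟨{⟨q, hq⟩}, q, by simp, hx⟩
    · rintro ⟨F, q, hq, hx⟩
      obtain ⟨q', -, rfl⟩ := Finset.mem_image.1 hq
      exact ⟨q', q'.2, hx⟩
  have hmono : Monotone fun F : Finset T =>
      ⋃ q ∈ F.image Subtype.val, Ioo (q : ℝ × ℝ).1 (q : ℝ × ℝ).2 := fun F G h =>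
    biUnion_subset_biUnion_left fun q hq => Finset.image_subset_image h hq
  rw [hU, hmono.directed_le.measure_iUnion, ENNReal.mul_iSup]
  refine iSup_le fun F => ?_
  have hF : ∀ q ∈ F.image Subtype.val, q ∈ S := fun q hq => by
    obtain ⟨q', -, rfl⟩ := Finset.mem_image.1 hq
    exact hTS q'.2
  obtain ⟨s, hs, hsc, hs2⟩ := exists_subcover_overlap_le_two (F.image Subtype.val)
  calc t * ν (⋃ q ∈ F.image Subtype.val, Ioo (q : ℝ × ℝ).1 (q : ℝ × ℝ).2)
      ≤ t * ∑ q ∈ s, ν (Ioo q.1 q.2) := by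
        gcongr
        exact (measure_mono hsc).trans (measure_biUnion_finset_le _ _)
    _ = ∑ q ∈ s, t * ν (Ioo q.1 q.2) := Finset.mul_sum _ _ _
    _ ≤ ∑ q ∈ s, ρ (Ioo q.1 q.2) := Finset.sum_le_sum fun q hq => hS q (hF q (hs hq))
    _ ≤ 2 * ρ D := sum_measure_Ioo_le_of_overlap ρ s (fun q hq => hD q (hF q (hs hq))) hs2

/-! ### The `A_p^+` condition on level sets and the testing inequality -/

/-- The one-sided Muckenhoupt condition with constant `K` for a pair of measures. -/
def ApPlusBound (p : ℝ) (K : ℝ≥0∞) (ω ν : Measure ℝ) : Prop :=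
  ∀ a b c : ℝ, a < b → b < c →
    ((ENNReal.ofReal (c - a))⁻¹ * ω (Ioo a b)) *
      ((ENNReal.ofReal (c - a))⁻¹ * ν (Ioo b c)) ^ (p - 1) ≤ K

lemma apPlusBound_apPlusConst (p : ℝ) (w : ℝ → ℝ≥0∞) :
    ApPlusBound p (apPlusConst p w) (volume.withDensity w)
      (volume.withDensity (dualWeight p w)) := by
  intro a b c hab hbc
  rw [withDensity_apply _ measurableSet_Ioo, withDensity_apply _ measurableSet_Ioo, apPlusConst]
  exact le_iSup_of_le a <| le_iSup_of_le b <| le_iSup_of_le c <| le_iSup₂_of_le hab hbc le_rfl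

/-- If every final segment of `(a, b)` has `ν`-density at least `l`, then the Muckenhoupt condition
bounds `ω (a, b)` by summing over segments of `(a, b)` whose lengths halve towards `b`. -/
lemma ApPlusBound.measure_Ioo_mul_rpow_le {p : ℝ} (hp : 1 < p) {K : ℝ≥0∞} {ω ν : Measure ℝ}
    [NullSingletonClass ω] (hK : ApPlusBound p K ω ν) {a b l : ℝ} (hab : a < b)
    (hν : ∀ x ∈ Ioo a b, ENNReal.ofReal (l * (b - x)) ≤ ν (Ioo x b)) :
    ω (Ioo a b) * ENNReal.ofReal l ^ (p - 1) ≤ 2 ^ p * K * ENNReal.ofReal (b - a) := by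
  let d : ℕ → ℝ := fun k => (b - a) * (1 / 2) ^ k
  let x : ℕ → ℝ := fun k => b - d k
  have hba : 0 < b - a := sub_pos.2 hab
  have hd : ∀ k, 0 < d k := fun k => by positivity
  have hds : ∀ k, d (k + 1) = d k / 2 := fun k => by simp only [d, pow_succ]; ring
  have hx : ∀ k, x k < x (k + 1) := fun k => by
    simp only [x, hds]; linarith [hd k]
  have hxb : ∀ k, x k < b := fun k => by simp only [x]; linarith [hd k]
  have hda : ∀ k, d k ≤ b - a := fun k =>
    mul_le_of_le_one_right hba.le (pow_le_one₀ (by norm_num) (by norm_num))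
  have hcover : Ioo a b ⊆ ⋃ k, Ico (x k) (x (k + 1)) := by
    intro y hy
    have hex : ∃ k, y < x k := by
      obtain ⟨k, hk⟩ := exists_pow_lt_of_lt_one (show 0 < (b - y) / (b - a) from
        div_pos (sub_pos.2 hy.2) hba) (show (1 / 2 : ℝ) < 1 by norm_num)
      refine ⟨k, ?_⟩
      have := (lt_div_iff₀ hba).1 hk
      simp only [x, d]; linarith
    classical
    have h1 := Nat.find_spec hex
    have h0 : Nat.find hex ≠ 0 := by
      intro h
      rw [h] at h1
      simp only [x, d, pow_zero] at h1
      linarith [hy.1]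
    obtain ⟨k, hk⟩ := Nat.exists_eq_succ_of_ne_zero h0
    have h2 : ¬ y < x k := Nat.find_min hex (by omega)
    exact mem_iUnion.2 ⟨k, not_lt.1 h2, by rw [hk] at h1; exact h1⟩
  -- The condition is applied to `x k < x (k + 1) < b`. The right part is half of `(x k, b)`, so its
  -- mass over the full length is at least `l / 2`; hence `2 ^ (p - 1)`. The remaining factor 2 is
  -- the sum of the lengths `d k`.
  have hpiece : ∀ k, ω (Ico (x k) (x (k + 1))) * ENNReal.ofReal l ^ (p - 1)
      ≤ 2 ^ (p - 1) * K * ENNReal.ofReal (d k) := by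
    intro k
    have h1 := hK (x k) (x (k + 1)) b (hx k) (hxb _)
    have hdk : b - x k = d k := by simp [x]
    rw [hdk] at h1
    have hd0 : ENNReal.ofReal (d k) ≠ 0 := by simpa using hd k
    have h2 : ENNReal.ofReal l / 2 ≤ (ENNReal.ofReal (d k))⁻¹ * ν (Ioo (x (k + 1)) b) := by
      have h3 := hν (x (k + 1)) ⟨?_, hxb _⟩
      · have h4 : l * (b - x (k + 1)) = d k * (l / 2) := by simp only [x, hds]; ring
        calc ENNReal.ofReal l / 2
            = (ENNReal.ofReal (d k))⁻¹ * ENNReal.ofReal (l * (b - x (k + 1))) := by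
              rw [h4, ENNReal.ofReal_mul (hd k).le, ← mul_assoc,
                ENNReal.inv_mul_cancel hd0 ENNReal.ofReal_ne_top, one_mul,
                ENNReal.ofReal_div_of_pos (by norm_num)]
              norm_num
          _ ≤ _ := by gcongr
      · simp only [x, hds]; linarith [hda k]
    have h4 : (ENNReal.ofReal (d k))⁻¹ * ω (Ioo (x k) (x (k + 1))) *
        (ENNReal.ofReal l / 2) ^ (p - 1) ≤ K :=
      le_trans (by gcongr) h1
    rw [measure_congr Ioo_ae_eq_Ico.symm]
    have h2p : (2 : ℝ≥0∞) ^ (p - 1) ≠ 0 := by simp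
    have h2p' : (2 : ℝ≥0∞) ^ (p - 1) ≠ ∞ := by simp
    calc ω (Ioo (x k) (x (k + 1))) * ENNReal.ofReal l ^ (p - 1)
        = 2 ^ (p - 1) * ((ENNReal.ofReal (d k))⁻¹ * ω (Ioo (x k) (x (k + 1))) *
            (ENNReal.ofReal l / 2) ^ (p - 1)) * ENNReal.ofReal (d k) := by
          rw [ENNReal.div_rpow_of_nonneg _ _ (by linarith), ENNReal.div_eq_inv_mul]
          calc _ = ((2 : ℝ≥0∞) ^ (p - 1) * (2 ^ (p - 1))⁻¹) *
                ((ENNReal.ofReal (d k))⁻¹ * ENNReal.ofReal (d k)) *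
                (ω (Ioo (x k) (x (k + 1))) * ENNReal.ofReal l ^ (p - 1)) := by
                rw [ENNReal.mul_inv_cancel h2p h2p',
                  ENNReal.inv_mul_cancel hd0 ENNReal.ofReal_ne_top, one_mul, one_mul]
            _ = _ := by ring
      _ ≤ _ := by gcongr
  have hsum : ∑' k, ENNReal.ofReal (d k) = 2 * ENNReal.ofReal (b - a) := by
    have : ∀ k, ENNReal.ofReal (d k) = ENNReal.ofReal (b - a) * (2⁻¹) ^ k := fun k => by
      rw [ENNReal.ofReal_mul hba.le, ENNReal.ofReal_pow (by norm_num), one_div,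
        ENNReal.ofReal_inv_of_pos (by norm_num)]
      norm_num
    simp_rw [this]
    rw [ENNReal.tsum_mul_left, ENNReal.tsum_geometric, ENNReal.one_sub_inv_two, inv_inv, mul_comm]
  calc ω (Ioo a b) * ENNReal.ofReal l ^ (p - 1)
      ≤ (∑' k, ω (Ico (x k) (x (k + 1)))) * ENNReal.ofReal l ^ (p - 1) := by
        gcongr
        exact (measure_mono hcover).trans (measure_iUnion_le _)
    _ = ∑' k, ω (Ico (x k) (x (k + 1))) * ENNReal.ofReal l ^ (p - 1) := ENNReal.tsum_mul_right.symm
    _ ≤ ∑' k, 2 ^ (p - 1) * K * ENNReal.ofReal (d k) := ENNReal.tsum_le_tsum hpiece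
    _ = 2 ^ (p - 1) * K * (2 * ENNReal.ofReal (b - a)) := by rw [ENNReal.tsum_mul_left, hsum]
    _ = (2 ^ (p - 1) * 2 ^ (1 : ℝ)) * K * ENNReal.ofReal (b - a) := by
        rw [ENNReal.rpow_one]; ring
    _ = 2 ^ p * K * ENNReal.ofReal (b - a) := by
        rw [← ENNReal.rpow_add _ _ (by norm_num) (by norm_num)]; simp

lemma lt_inv_ofReal_mul_iff {l z : ℝ} (hz : 0 < z) {m : ℝ≥0∞} :
    ENNReal.ofReal l < (ENNReal.ofReal z)⁻¹ * m ↔ ENNReal.ofReal (l * z) < m := by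
  rw [mul_comm, ← div_eq_mul_inv, ENNReal.lt_div_iff_mul_lt (Or.inl (by simpa using hz))
    (Or.inl ENNReal.ofReal_ne_top), ENNReal.ofReal_mul' hz.le]

/-- The part of `(a, b)` on which the forward maximal function of `ν` on `(a, b)` exceeds `l`. -/
def fwdLevel (ν : Measure ℝ) (a b l : ℝ) : Set ℝ :=
  {x ∈ Ioo a b | ENNReal.ofReal l < fwdMax (ν.restrict (Ioo a b)) x}

lemma isOpen_fwdLevel (ν : Measure ℝ) (a b l : ℝ) : IsOpen (fwdLevel ν a b l) :=
  isOpen_Ioo.inter ((lowerSemicontinuous_fwdMax _).isOpen_preimage _)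

/-- The rising sun property of the components of the level sets. -/
lemma le_measure_Ioo_of_mem_gaps_fwdLevel {ν : Measure ℝ} [NullSingletonClass ν] {a b l : ℝ}
    (hl : 0 < l) {q : ℝ × ℝ} (hq : q ∈ gaps (fwdLevel ν a b l)) {x : ℝ}
    (hx : x ∈ Ioo q.1 q.2) : ENNReal.ofReal (l * (q.2 - x)) ≤ ν (Ioo x q.2) := by
  obtain ⟨hq0, hqU, hq1, hq2⟩ := hq
  have hqC : Ioo q.1 q.2 ⊆ Ioo a b := fun y hy => (hqU hy).1
  have hqab := (Ioo_subset_Ioo_iff hq0).1 hqC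
  -- `S` collects the `y` for which `(x, y)` has density at least `l`. Its supremum must be `q.2`:
  -- otherwise it lies in the level set, and a forward interval of high density extends `S`.
  let S : Set ℝ := {y ∈ Icc x q.2 | ENNReal.ofReal (l * (y - x)) ≤ ν (Ioo x y)}
  have hxS : x ∈ S := ⟨⟨le_rfl, hx.2.le⟩, by simp⟩
  have hSb : BddAbove S := ⟨q.2, fun y hy => hy.1.2⟩
  set y0 := sSup S
  have hxy0 : x ≤ y0 := le_csSup hSb hxS
  have hy0q : y0 ≤ q.2 := csSup_le ⟨x, hxS⟩ fun y hy => hy.1.2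
  have hy0 : ENNReal.ofReal (l * (y0 - x)) ≤ ν (Ioo x y0) := by
    by_cases htop : ν (Ioo x y0) = ∞
    · rw [htop]; exact le_top
    rw [ENNReal.ofReal_le_iff_le_toReal htop]
    have : y0 ≤ x + (ν (Ioo x y0)).toReal / l := by
      refine csSup_le ⟨x, hxS⟩ fun y hy => ?_
      have h1 : ENNReal.ofReal (l * (y - x)) ≤ ν (Ioo x y0) :=
        hy.2.trans (measure_mono (Ioo_subset_Ioo_right (le_csSup hSb hy)))
      rw [ENNReal.ofReal_le_iff_le_toReal htop] at h1
      rw [← sub_le_iff_le_add', le_div_iff₀ hl]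
      linarith
    rw [← sub_le_iff_le_add', le_div_iff₀ hl] at this
    linarith
  rcases hy0q.lt_or_eq with hlt | heq
  swap
  · rwa [heq] at hy0
  exfalso
  have step : ∀ y, y0 < y → y ≤ q.2 → ENNReal.ofReal (l * (y - y0)) ≤ ν (Ioo y0 y) → False := by
    intro y h1 h2 h3
    refine (le_csSup hSb (show y ∈ S from ⟨⟨hxy0.trans h1.le, h2⟩, ?_⟩)).not_gt h1
    have hdisj : Disjoint (Ioo x y0) (Ioo y0 y) :=
      Set.disjoint_left.2 fun z hz hz' => (hz.2.trans hz'.1).false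
    calc ENNReal.ofReal (l * (y - x))
        = ENNReal.ofReal (l * (y0 - x)) + ENNReal.ofReal (l * (y - y0)) := by
          rw [← ENNReal.ofReal_add (mul_nonneg hl.le (by linarith))
            (mul_nonneg hl.le (by linarith))]
          congr 1; ring
      _ ≤ ν (Ioo x y0) + ν (Ioo y0 y) := add_le_add hy0 h3
      _ = ν (Ioo x y0 ∪ Ioo y0 y) := (measure_union hdisj measurableSet_Ioo).symm
      _ ≤ ν (Ioo x y) := measure_mono (union_subset (Ioo_subset_Ioo_right h1.le)
          (Ioo_subset_Ioo_left hxy0))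
  have hy0U := (hqU ⟨hx.1.trans_le hxy0, hlt⟩).2
  obtain ⟨y1, h01, hy1⟩ := lt_fwdMax_iff.1 hy0U
  rw [lt_inv_ofReal_mul_iff (sub_pos.2 h01), Measure.restrict_apply measurableSet_Ioo] at hy1
  rcases le_or_gt y1 q.2 with h1q | h1q
  · exact step y1 h01 h1q (hy1.le.trans (measure_mono inter_subset_left))
  refine step q.2 hlt le_rfl ?_
  -- The dense interval overshoots `q.2`. If `q.2 < b`, the part beyond has density at most `l`
  -- because `q.2` is off the level set, so the part before is dense; if `q.2 = b`, there is no mass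
  -- beyond.
  rcases hqab.2.lt_or_eq with hqb | hqb
  · have hq2' : ¬ ENNReal.ofReal l < fwdMax (ν.restrict (Ioo a b)) q.2 := fun h =>
      hq2 ⟨⟨hqab.1.trans_lt hq0, hqb⟩, h⟩
    have h2 : ν (Ioo q.2 y1 ∩ Ioo a b) ≤ ENNReal.ofReal (l * (y1 - q.2)) := by
      by_contra! h
      rw [← Measure.restrict_apply measurableSet_Ioo,
        ← lt_inv_ofReal_mul_iff (sub_pos.2 h1q)] at h
      exact hq2' (h.trans_le (le_fwdMax _ h1q))
    have h3 : ν (Ioo y0 y1 ∩ Ioo a b) ≤ ν (Ioo y0 q.2) + ν (Ioo q.2 y1 ∩ Ioo a b) := by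
      calc ν (Ioo y0 y1 ∩ Ioo a b)
          ≤ ν (Ioc y0 q.2 ∪ (Ioo q.2 y1 ∩ Ioo a b)) := by
            refine measure_mono fun z hz => ?_
            rcases le_or_gt z q.2 with h | h
            · exact Or.inl ⟨hz.1.1, h⟩
            · exact Or.inr ⟨⟨h, hz.1.2⟩, hz.2⟩
        _ ≤ ν (Ioc y0 q.2) + ν (Ioo q.2 y1 ∩ Ioo a b) := measure_union_le _ _
        _ = _ := by rw [measure_congr Ioo_ae_eq_Ioc]
    have h4 : ENNReal.ofReal (l * (q.2 - y0)) + ENNReal.ofReal (l * (y1 - q.2))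
        ≤ ν (Ioo y0 q.2) + ENNReal.ofReal (l * (y1 - q.2)) := by
      rw [← ENNReal.ofReal_add (mul_nonneg hl.le (by linarith)) (mul_nonneg hl.le (by linarith))]
      have : l * (q.2 - y0) + l * (y1 - q.2) = l * (y1 - y0) := by ring
      rw [this]
      exact hy1.le.trans (h3.trans (by gcongr))
    exact (ENNReal.add_le_add_iff_right ENNReal.ofReal_ne_top).1 h4
  · have h5 : Ioo y0 y1 ∩ Ioo a b ⊆ Ioo y0 q.2 := fun z hz => ⟨hz.1.1, hqb ▸ hz.2.2⟩
    refine le_trans (ENNReal.ofReal_le_ofReal ?_) (hy1.le.trans (measure_mono h5))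
    gcongr

lemma ApPlusBound.measure_fwdLevel_mul_rpow_le {p : ℝ} (hp : 1 < p) {K : ℝ≥0∞}
    {ω ν : Measure ℝ} [NullSingletonClass ω] [NullSingletonClass ν] (hK : ApPlusBound p K ω ν)
    (a b : ℝ) {l : ℝ} (hl : 0 < l) :
    ω (fwdLevel ν a b l) * ENNReal.ofReal l ^ (p - 1) ≤ 2 ^ p * K * volume (fwdLevel ν a b l) := by
  have hU := isOpen_fwdLevel ν a b l
  have hsub : fwdLevel ν a b l ⊆ Ioo a b := fun x hx => hx.1
  rw [measure_eq_tsum_gaps ω hU hsub, measure_eq_tsum_gaps volume hU hsub,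
    ← ENNReal.tsum_mul_right, ← ENNReal.tsum_mul_left]
  refine ENNReal.tsum_le_tsum fun q => ?_
  rw [Real.volume_Ioo]
  exact hK.measure_Ioo_mul_rpow_le hp q.2.1
    fun x hx => le_measure_Ioo_of_mem_gaps_fwdLevel hl q.2 hx

/-- Monotone convergence. Truncations have finite integral over bounded intervals, which later
allows a power of that integral to be cancelled. -/
lemma lintegral_rpow_le_of_forall_min {μ : Measure ℝ} {G : ℝ → ℝ≥0∞} (hG : Measurable G)
    {q : ℝ} (hq : 0 < q) {B : ℝ≥0∞} (h : ∀ N : ℕ, ∫⁻ x, min (G x) N ^ q ∂μ ≤ B) :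
    ∫⁻ x, G x ^ q ∂μ ≤ B := by
  have hsup : ∀ z : ℝ≥0∞, z ^ q = ⨆ N : ℕ, min z N ^ q := fun z => by
    have h1 : z = ⨆ N : ℕ, min z N := by
      rw [← inf_iSup_eq, ENNReal.iSup_natCast, inf_top_eq]
    have h2 := (ENNReal.orderIsoRpow q hq).map_iSup fun N : ℕ => min z N
    simp only [ENNReal.orderIsoRpow_apply] at h2
    rw [← h2, ← h1]
  simp_rw [fun x => hsup (G x)]
  rw [lintegral_iSup (fun N => (hG.min measurable_const).pow_const q)]
  · exact iSup_le h
  · intro M N hMN x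
    dsimp only
    gcongr

lemma lintegral_le_of_forall_min {μ : Measure ℝ} {G : ℝ → ℝ≥0∞} (hG : Measurable G)
    {B : ℝ≥0∞} (h : ∀ N : ℕ, ∫⁻ x, min (G x) N ∂μ ≤ B) : ∫⁻ x, G x ∂μ ≤ B := by
  simpa using lintegral_rpow_le_of_forall_min hG one_pos (by simpa using h)

/-- The truncated testing inequality, by the layer cake formula. -/
lemma ApPlusBound.setLIntegral_min_fwdMax_rpow_le {p : ℝ} (hp : 1 < p) {K : ℝ≥0∞}
    {ω ν : Measure ℝ} [NullSingletonClass ω] [NullSingletonClass ν] (hK : ApPlusBound p K ω ν)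
    (hKtop : K ≠ ∞) (a b : ℝ) (N : ℕ) :
    ∫⁻ x in Ioo a b, min (fwdMax (ν.restrict (Ioo a b)) x) N ^ p ∂ω ≤
      ENNReal.ofReal p * (2 ^ p * K) *
        ∫⁻ x in Ioo a b, min (fwdMax (ν.restrict (Ioo a b)) x) N := by
  set F := fwdMax (ν.restrict (Ioo a b))
  have hF : Measurable F := measurable_fwdMax _
  have hfin : ∀ x, min (F x) N ≠ ∞ := fun x =>
    ((min_le_right _ _).trans_lt (ENNReal.natCast_lt_top N)).ne
  let f : ℝ → ℝ := fun x => (min (F x) N).toReal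
  have hf : Measurable f := (hF.min measurable_const).ennreal_toReal
  have hf0 : ∀ x, 0 ≤ f x := fun x => ENNReal.toReal_nonneg
  have hfF : ∀ x, min (F x) N = ENNReal.ofReal (f x) := fun x =>
    (ENNReal.ofReal_toReal (hfin x)).symm
  have hlev : ∀ t, 0 < t → {x | t < f x} ∩ Ioo a b =
      if t < N then fwdLevel ν a b t else ∅ := by
    intro t ht
    have : ∀ x, t < f x ↔ ENNReal.ofReal t < F x ∧ t < N := fun x => by
      rw [← ENNReal.ofReal_lt_iff_lt_toReal ht.le (hfin x), lt_min_iff]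
      have : ENNReal.ofReal t < (N : ℝ≥0∞) ↔ t < N := by
        rw [← ENNReal.ofReal_natCast, ENNReal.ofReal_lt_ofReal_iff_of_nonneg ht.le]
      rw [this]
    ext x
    split_ifs with h <;> simp [this, h, fwdLevel, F, and_comm]
  simp_rw [hfF, ENNReal.ofReal_rpow_of_nonneg (hf0 _) (zero_lt_one.trans hp).le]
  rw [lintegral_rpow_eq_lintegral_meas_lt_mul _ (ae_of_all _ hf0) hf.aemeasurable (by linarith),
    lintegral_eq_lintegral_meas_lt _ (ae_of_all _ hf0) hf.aemeasurable, mul_assoc]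
  gcongr
  rw [← lintegral_const_mul']
  swap
  · exact ENNReal.mul_ne_top (by simp) hKtop
  refine setLIntegral_mono' measurableSet_Ioi fun t ht => ?_
  have ht : 0 < t := ht
  have hms : MeasurableSet {x | t < f x} := measurableSet_lt measurable_const hf
  rw [Measure.restrict_apply hms, Measure.restrict_apply hms, hlev t ht]
  split_ifs with h
  · rw [← ENNReal.ofReal_rpow_of_pos ht]
    exact hK.measure_fwdLevel_mul_rpow_le hp a b ht
  · simp

lemma ApPlusBound.setLIntegral_fwdMax_rpow_le {p : ℝ} (hp : 1 < p) {K : ℝ≥0∞}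
    {ω ν : Measure ℝ} [NullSingletonClass ω] [NullSingletonClass ν] (hK : ApPlusBound p K ω ν)
    (hKtop : K ≠ ∞) (a b : ℝ) :
    ∫⁻ x in Ioo a b, fwdMax (ν.restrict (Ioo a b)) x ^ p ∂ω ≤
      ENNReal.ofReal p * (2 ^ p * K) * ∫⁻ x in Ioo a b, fwdMax (ν.restrict (Ioo a b)) x := by
  refine lintegral_rpow_le_of_forall_min (measurable_fwdMax _) (by linarith) fun N =>
    (hK.setLIntegral_min_fwdMax_rpow_le hp hKtop a b N).trans ?_
  gcongr
  exact min_le_left _ _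

/-! ### The dual weight and its `A_∞^-` constant -/

lemma dualWeight_ne_zero {p : ℝ} (hp : 1 < p) {w : ℝ → ℝ≥0∞} {x : ℝ} (hx : w x < ∞) :
    dualWeight p w x ≠ 0 := by
  have : 0 < 1 / (p - 1) := one_div_pos.2 (by linarith)
  rw [dualWeight, ENNReal.rpow_neg]
  exact ENNReal.inv_ne_zero.2 (ENNReal.rpow_lt_top_of_nonneg this.le hx.ne).ne

lemma ne_zero_of_dualWeight_lt_top {p : ℝ} (hp : 1 < p) {w : ℝ → ℝ≥0∞} {x : ℝ}
    (hx : dualWeight p w x < ∞) : w x ≠ 0 := by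
  intro h
  have : 0 < 1 / (p - 1) := one_div_pos.2 (by linarith)
  rw [dualWeight, h, ENNReal.zero_rpow_of_neg (by linarith)] at hx
  exact hx.ne rfl

lemma measurable_dualWeight (p : ℝ) {w : ℝ → ℝ≥0∞} (hw : Measurable w) :
    Measurable (dualWeight p w) := hw.pow_const _

lemma ae_dualWeight_lt_top {p : ℝ} {w : ℝ → ℝ≥0∞} (hw : Measurable w) {s : Set ℝ}
    (hs : MeasurableSet s) (hfin : volume.withDensity (dualWeight p w) s ≠ ∞) :
    ∀ᵐ x ∂volume.restrict s, dualWeight p w x < ∞ := by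
  rw [withDensity_apply _ hs] at hfin
  exact ae_lt_top (measurable_dualWeight p hw) hfin

/-- The local estimate behind `[σ]_{A_∞^-} ≤ C [w]_{A_p^+}^{1/(p-1)}`. -/
lemma setLIntegral_fwdMax_dualWeight_le {p : ℝ} (hp : 1 < p) {w : ℝ → ℝ≥0∞} (hw : Measurable w)
    (hw' : ∀ᵐ x, w x < ∞) (hKtop : apPlusConst p w ≠ ∞) (a b : ℝ)
    (hfin : volume.withDensity (dualWeight p w) (Ioo a b) ≠ ∞) :
    ∫⁻ x in Ioo a b, fwdMax ((volume.withDensity (dualWeight p w)).restrict (Ioo a b)) x ≤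
      (ENNReal.ofReal p * (2 ^ p * apPlusConst p w)) ^ (1 / (p - 1)) *
        volume.withDensity (dualWeight p w) (Ioo a b) := by
  set ν := volume.withDensity (dualWeight p w)
  set F := fwdMax (ν.restrict (Ioo a b))
  set c := ENNReal.ofReal p * (2 ^ p * apPlusConst p w)
  have hF : Measurable F := measurable_fwdMax _
  have hp0 : 0 < p := by linarith
  have hp1 : 0 < p - 1 := by linarith
  refine lintegral_le_of_forall_min hF fun N => ?_
  set X := ∫⁻ x in Ioo a b, min (F x) N
  have hXtop : X ≠ ∞ := by
    have : X ≤ N * volume (Ioo a b) := by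
      rw [← setLIntegral_const]
      exact lintegral_mono fun x => min_le_right _ _
    exact (this.trans_lt (ENNReal.mul_lt_top (by simp) (by simp))).ne
  have hcon : p.HolderConjugate (p / (p - 1)) := Real.HolderConjugate.conjExponent hp
  have h1 : X ≤ (c * X) ^ (1 / p) * ν (Ioo a b) ^ (1 / (p / (p - 1))) := by
    -- Hölder with the splitting `F = (F w^(1/p)) w^(-1/p)`: the conjugate power of the last factor
    -- is `σ`. Finite mass of `σ` gives `w ≠ 0` almost everywhere.
    calc X = ∫⁻ x in Ioo a b,
          ((fun x => min (F x) N * w x ^ (1 / p)) * fun x => w x ^ (-(1 / p))) x := by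
          refine lintegral_congr_ae ?_
          filter_upwards [ae_dualWeight_lt_top hw measurableSet_Ioo hfin,
            ae_restrict_of_ae hw'] with x hx hx'
          have h0 := ne_zero_of_dualWeight_lt_top hp hx
          rw [Pi.mul_apply, mul_assoc, ← ENNReal.rpow_add _ _ h0 hx'.ne]
          simp
      _ ≤ _ := ENNReal.lintegral_mul_le_Lp_mul_Lq _ hcon
          ((hF.min measurable_const).mul (hw.pow_const _)).aemeasurable
          (hw.pow_const _).aemeasurable
      _ ≤ _ := by
          gcongr
          · refine le_trans (le_of_eq ?_)
              ((apPlusBound_apPlusConst p w).setLIntegral_min_fwdMax_rpow_le hp hKtop a b N)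
            rw [restrict_withDensity measurableSet_Ioo,
              lintegral_withDensity_eq_lintegral_mul _ hw
                ((hF.min measurable_const).pow_const p)]
            refine lintegral_congr fun x => ?_
            rw [ENNReal.mul_rpow_of_nonneg _ _ hp0.le, ← ENNReal.rpow_mul,
              one_div_mul_cancel hp0.ne', ENNReal.rpow_one, Pi.mul_apply, mul_comm]
          · rw [withDensity_apply _ measurableSet_Ioo]
            refine le_of_eq (lintegral_congr fun x => ?_)
            rw [← ENNReal.rpow_mul, dualWeight]
            congr 1
            field_simp
  by_cases hX0 : X = 0
  · simp [hX0]
  have e1 : 1 / (p / (p - 1)) = (p - 1) / p := by rw [one_div_div]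
  -- Absorbs `X ^ (1 / p)` into the left side, legitimate because the truncation makes `X` finite.
  have h2 : X ^ ((p - 1) / p) ≤ c ^ (1 / p) * ν (Ioo a b) ^ ((p - 1) / p) := by
    rw [ENNReal.mul_rpow_of_nonneg _ _ (by positivity), e1] at h1
    have h3 : X ^ ((p - 1) / p) = X * X ^ (-(1 / p)) := by
      conv_rhs => rw [← ENNReal.rpow_one X, ← ENNReal.rpow_mul, ← ENNReal.rpow_add _ _ hX0 hXtop]
      congr 1
      field_simp
      ring
    calc X ^ ((p - 1) / p) = X * X ^ (-(1 / p)) := h3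
      _ ≤ c ^ (1 / p) * X ^ (1 / p) * ν (Ioo a b) ^ ((p - 1) / p) * X ^ (-(1 / p)) := by gcongr
      _ = c ^ (1 / p) * ν (Ioo a b) ^ ((p - 1) / p) * (X ^ (1 / p) * X ^ (-(1 / p))) := by ring
      _ = _ := by rw [← ENNReal.rpow_add _ _ hX0 hXtop]; simp
  have h3 := ENNReal.rpow_le_rpow h2 (show 0 ≤ p / (p - 1) by positivity)
  rw [ENNReal.mul_rpow_of_nonneg _ _ (by positivity), ← ENNReal.rpow_mul, ← ENNReal.rpow_mul,
    ← ENNReal.rpow_mul] at h3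
  have e2 : (p - 1) / p * (p / (p - 1)) = 1 := by field_simp
  have e3 : 1 / p * (p / (p - 1)) = 1 / (p - 1) := by field_simp
  rwa [e2, e3, ENNReal.rpow_one, ENNReal.rpow_one] at h3

lemma aInftyMinusConst_dualWeight_le {p : ℝ} (hp : 1 < p) {w : ℝ → ℝ≥0∞} (hw : Measurable w)
    (hw' : ∀ᵐ x, w x < ∞) (hKtop : apPlusConst p w ≠ ∞) :
    aInftyMinusConst (dualWeight p w) ≤
      (ENNReal.ofReal p * (2 ^ p * apPlusConst p w)) ^ (1 / (p - 1)) := by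
  refine iSup_le fun a => iSup_le fun b => iSup_le fun _ => ?_
  rw [maximalPlus_indicator _ measurableSet_Ioo,
    ← withDensity_apply (dualWeight p w) measurableSet_Ioo]
  by_cases htop : volume.withDensity (dualWeight p w) (Ioo a b) = ∞
  · simp [htop]
  · exact ENNReal.div_le_of_le_mul (setLIntegral_fwdMax_dualWeight_le hp hw hw' hKtop a b htop)

/-- The testing inequality with the constant `[w]_{A_p^+} [σ]_{A_∞^-}`. -/
lemma testing_fwdMax_dualWeight {p : ℝ} (hp : 1 < p) {w : ℝ → ℝ≥0∞}
    (hKtop : apPlusConst p w ≠ ∞) {a b : ℝ} (hab : a < b)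
    (hfin : volume.withDensity (dualWeight p w) (Ioo a b) ≠ ∞)
    (hpos : volume.withDensity (dualWeight p w) (Ioo a b) ≠ 0) :
    ∫⁻ x in Ioo a b, fwdMax ((volume.withDensity (dualWeight p w)).restrict (Ioo a b)) x ^ p
        ∂volume.withDensity w ≤
      ENNReal.ofReal p * 2 ^ p * (apPlusConst p w * aInftyMinusConst (dualWeight p w)) *
        volume.withDensity (dualWeight p w) (Ioo a b) := by
  have h1 : ∫⁻ x in Ioo a b, fwdMax ((volume.withDensity (dualWeight p w)).restrict (Ioo a b)) x
      ≤ aInftyMinusConst (dualWeight p w) * volume.withDensity (dualWeight p w) (Ioo a b) := by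
    rw [← ENNReal.div_le_iff hpos hfin, ← maximalPlus_indicator _ measurableSet_Ioo,
      withDensity_apply _ measurableSet_Ioo]
    exact le_iSup_of_le a <| le_iSup_of_le b <| le_iSup_of_le hab le_rfl
  refine ((apPlusBound_apPlusConst p w).setLIntegral_fwdMax_rpow_le hp hKtop a b).trans ?_
  calc _ ≤ ENNReal.ofReal p * (2 ^ p * apPlusConst p w) *
        (aInftyMinusConst (dualWeight p w) *
          volume.withDensity (dualWeight p w) (Ioo a b)) := by gcongr
    _ = _ := by ring

/-! ### From testing to the strong type inequality on an interval -/

/-- A geometric series running down from the largest `m` with `2 ^ m < G`. -/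
lemma tsum_zpow_rpow_le {s : ℝ} (hs : 0 < s) (G : ℝ≥0∞) :
    ∑' m : ℤ, (if (2 : ℝ≥0∞) ^ m < G then ((2 : ℝ≥0∞) ^ m) ^ s else 0) ≤
      (1 - (2 : ℝ≥0∞) ^ (-s))⁻¹ * G ^ s := by
  have h2 : (2 : ℝ≥0∞) ≠ 0 := by norm_num
  have h2' : (2 : ℝ≥0∞) ≠ ∞ := by norm_num
  by_cases hG0 : G = 0
  · simp [hG0]
  by_cases hGtop : G = ∞
  · rw [hGtop, ENNReal.top_rpow_of_pos hs, ENNReal.mul_top]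
    · exact le_top
    · exact ENNReal.inv_ne_zero.2 (ne_top_of_le_ne_top ENNReal.one_ne_top tsub_le_self)
  obtain ⟨m₀, hm₀, hm₀'⟩ := ENNReal.exists_mem_Ioc_zpow hG0 hGtop
    (show (1 : ℝ≥0∞) < 2 by norm_num) h2'
  let g : ℕ → ℤ := fun k => m₀ - k
  have hg : Function.Injective g := fun i j h => by simp only [g] at h; omega
  have hsupp : Function.support
      (fun m : ℤ => if (2 : ℝ≥0∞) ^ m < G then ((2 : ℝ≥0∞) ^ m) ^ s else 0) ⊆ range g := by
    intro m hm
    have h1 : (2 : ℝ≥0∞) ^ m < G := by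
      by_contra h
      simp [h] at hm
    have h3 : m ≤ m₀ := by
      by_contra! h
      exact (h1.trans_le hm₀').not_ge (ENNReal.zpow_le_of_le (by norm_num) (by omega))
    exact ⟨(m₀ - m).toNat, by simp only [g]; omega⟩
  rw [← hg.tsum_eq hsupp]
  calc _ ≤ ∑' k : ℕ, ((2 : ℝ≥0∞) ^ m₀) ^ s * ((2 : ℝ≥0∞) ^ (-s)) ^ k := by
        refine ENNReal.tsum_le_tsum fun k => ?_
        have : ((2 : ℝ≥0∞) ^ g k) ^ s = ((2 : ℝ≥0∞) ^ m₀) ^ s * ((2 : ℝ≥0∞) ^ (-s)) ^ k := by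
          rw [← ENNReal.rpow_intCast, ← ENNReal.rpow_intCast, ← ENNReal.rpow_natCast,
            ← ENNReal.rpow_mul, ← ENNReal.rpow_mul, ← ENNReal.rpow_mul,
            ← ENNReal.rpow_add _ _ h2 h2']
          congr 1
          simp only [g]; push_cast; ring
        split_ifs
        · exact this.le
        · exact zero_le
    _ = ((2 : ℝ≥0∞) ^ m₀) ^ s * (1 - (2 : ℝ≥0∞) ^ (-s))⁻¹ := by
        rw [ENNReal.tsum_mul_left, ENNReal.tsum_geometric]
    _ ≤ G ^ s * (1 - (2 : ℝ≥0∞) ^ (-s))⁻¹ := by gcongr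
    _ = _ := mul_comm _ _

/-- The union of the intervals contained in `D` on which the `ν`-average of `ρ` exceeds `t`. -/
def avgLevel (ν ρ : Measure ℝ) (D : Set ℝ) (t : ℝ≥0∞) : Set ℝ :=
  ⋃ q ∈ {q : ℝ × ℝ | Ioo q.1 q.2 ⊆ D ∧ t * ν (Ioo q.1 q.2) < ρ (Ioo q.1 q.2)}, Ioo q.1 q.2

lemma isOpen_avgLevel (ν ρ : Measure ℝ) (D : Set ℝ) (t : ℝ≥0∞) : IsOpen (avgLevel ν ρ D t) :=
  isOpen_biUnion fun _ _ => isOpen_Ioo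

lemma avgLevel_subset (ν ρ : Measure ℝ) (D : Set ℝ) (t : ℝ≥0∞) : avgLevel ν ρ D t ⊆ D :=
  iUnion₂_subset fun _ hq => hq.1

/-- The weak type inequality for the uncentred maximal operator with respect to `v`. -/
lemma mul_measure_avgLevel_le {v φ : ℝ → ℝ≥0∞} (hv : Measurable v) (hφ : Measurable φ)
    {D : Set ℝ} (hD : volume.withDensity v D ≠ ∞) {t : ℝ≥0∞} (ht : t ≠ ∞) :
    t * volume.withDensity v
        (avgLevel (volume.withDensity v) (volume.withDensity φ) D t) ≤
      4 * volume.withDensity φ ({x | t / 2 * v x < φ x} ∩ D) := by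
  set ν := volume.withDensity v
  set ρ := volume.withDensity φ
  set Q := {x | t / 2 * v x < φ x}
  have hQ : MeasurableSet Q := measurableSet_lt (hv.const_mul _) hφ
  have h := weakType_biUnion_Ioo ν (ρ.restrict Q) (t / 2)
    {q : ℝ × ℝ | Ioo q.1 q.2 ⊆ D ∧ t * ν (Ioo q.1 q.2) < ρ (Ioo q.1 q.2)} (D := D)
    (fun q hq => hq.1) (fun q hq => by
      have hI : ν (Ioo q.1 q.2) ≠ ∞ := ne_top_of_le_ne_top hD (measure_mono hq.1)
      -- Off `Q` the density of `ρ` is at most `t / 2` times `v`, so at least half of the required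
      -- mass comes from `Q`. This half and the overlap 2 make the final 4.
      have h1 : ρ (Ioo q.1 q.2) ≤ ρ.restrict Q (Ioo q.1 q.2) + t / 2 * ν (Ioo q.1 q.2) := by
        rw [← measure_inter_add_sdiff (μ := ρ) _ hQ, Measure.restrict_apply measurableSet_Ioo]
        gcongr
        rw [withDensity_apply _ (measurableSet_Ioo.diff hQ),
          withDensity_apply _ measurableSet_Ioo, ← lintegral_const_mul _ hv]
        calc ∫⁻ x in Ioo q.1 q.2 \ Q, φ x ≤ ∫⁻ x in Ioo q.1 q.2 \ Q, t / 2 * v x :=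
              setLIntegral_mono' (measurableSet_Ioo.diff hQ) fun x hx => not_lt.1 hx.2
          _ ≤ _ := lintegral_mono_set sdiff_subset
      have h2 : t / 2 * ν (Ioo q.1 q.2) + t / 2 * ν (Ioo q.1 q.2)
          ≤ ρ.restrict Q (Ioo q.1 q.2) + t / 2 * ν (Ioo q.1 q.2) := by
        rw [← add_mul, ENNReal.add_halves]
        exact hq.2.le.trans h1
      exact (ENNReal.add_le_add_iff_right
        (ENNReal.mul_ne_top (ENNReal.div_ne_top ht (by norm_num)) hI)).1 h2)
  have h3 : ρ.restrict Q D ≤ ρ (Q ∩ D) := by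
    rw [Measure.restrict_apply' hQ, inter_comm]
  calc t * ν (avgLevel ν ρ D t) = 2 * (t / 2 * ν (avgLevel ν ρ D t)) := by
        rw [← mul_assoc, ENNReal.mul_div_cancel (by norm_num) (by norm_num)]
    _ ≤ 2 * (2 * ρ (Q ∩ D)) := mul_le_mul_right (h.trans (mul_le_mul_right h3 2)) 2
    _ = _ := by rw [← mul_assoc]; norm_num

/-- The sum over the components of `U` of the powers of the local forward maximal functions. -/
noncomputable def localFwdMax (ν : Measure ℝ) (p : ℝ) (U : Set ℝ) (x : ℝ) : ℝ≥0∞ :=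
  ∑' q : gaps U, (Ioo (q : ℝ × ℝ).1 (q : ℝ × ℝ).2).indicator
    (fun x => fwdMax (ν.restrict (Ioo (q : ℝ × ℝ).1 (q : ℝ × ℝ).2)) x ^ p) x

lemma measurable_localFwdMax (ν : Measure ℝ) (p : ℝ) (U : Set ℝ) :
    Measurable (localFwdMax ν p U) := by
  have : Countable (gaps U) := gaps_countable U
  exact Measurable.tsum fun q =>
    ((measurable_fwdMax _).pow_const p).indicator measurableSet_Ioo

/-- The interval cannot pass the right end of the component of `x`, since that end is not in `U`. -/
lemma rpow_le_localFwdMax (ν : Measure ℝ) {p : ℝ} (hp : 0 ≤ p) {U : Set ℝ} (hU : IsOpen U)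
    {α β : ℝ} (hsub : U ⊆ Ioo α β) {x y : ℝ} (hxU : x ∈ U) (hxy : x < y) (h : Ioo x y ⊆ U) :
    ((ENNReal.ofReal (y - x))⁻¹ * ν (Ioo x y)) ^ p ≤ localFwdMax ν p U x := by
  obtain ⟨q, hq, hxq⟩ := mem_iUnion₂.1 ((biUnion_gaps hU hsub).symm ▸ hxU)
  have hy : y ≤ q.2 := by
    by_contra! hlt
    exact hq.2.2.2 (h ⟨hxq.2, hlt⟩)
  refine le_trans ?_ (ENNReal.le_tsum (⟨q, hq⟩ : gaps U))
  rw [indicator_of_mem hxq]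
  gcongr
  refine le_trans (le_of_eq ?_) (le_fwdMax _ hxy)
  rw [Measure.restrict_apply measurableSet_Ioo,
    inter_eq_self_of_subset_left (Ioo_subset_Ioo hxq.1.le hy)]

lemma lintegral_localFwdMax_le {ν ω : Measure ℝ} {p : ℝ} {U : Set ℝ} (hU : IsOpen U) {α β : ℝ}
    (hsub : U ⊆ Ioo α β) {B : ℝ≥0∞}
    (h : ∀ q ∈ gaps U, ∫⁻ x in Ioo q.1 q.2, fwdMax (ν.restrict (Ioo q.1 q.2)) x ^ p ∂ω ≤
      B * ν (Ioo q.1 q.2)) :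
    ∫⁻ x, localFwdMax ν p U x ∂ω ≤ B * ν U := by
  have : Countable (gaps U) := gaps_countable U
  unfold localFwdMax
  rw [lintegral_tsum fun q =>
    (((measurable_fwdMax _).pow_const p).indicator measurableSet_Ioo).aemeasurable,
    measure_eq_tsum_gaps ν hU hsub, ← ENNReal.tsum_mul_left]
  refine ENNReal.tsum_le_tsum fun q => ?_
  rw [lintegral_indicator measurableSet_Ioo]
  exact h q q.2

/-- `(x, y)` does not contain `x`. Moving the left end slightly back keeps the strict inequality and
puts `x` itself in the level set. -/
lemma exists_lt_mul_measure_Ioo_lt {ν : Measure ℝ} [NullSingletonClass ν] {α x y : ℝ}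
    (hx : α < x) (hfin : ν (Ioo α y) ≠ ∞) {t M : ℝ≥0∞} (ht : t ≠ ∞)
    (h : t * ν (Ioo x y) < M) : ∃ u, α < u ∧ u < x ∧ t * ν (Ioo u y) < M := by
  let u : ℕ → ℝ := fun n => x - (x - α) / (n + 2)
  have hpos : 0 < x - α := sub_pos.2 hx
  have hu : ∀ n, α < u n := fun n => by
    have : (x - α) / (n + 2) < x - α := div_lt_self hpos (by linarith [n.cast_nonneg (α := ℝ)])
    simp only [u]; linarith
  have hux : ∀ n, u n < x := fun n => by
    have : 0 < (x - α) / (n + 2) := by positivity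
    simp only [u]; linarith
  have hanti : Antitone fun n => Ioo (u n) y := fun m n hmn => by
    refine Ioo_subset_Ioo_left ?_
    simp only [u]
    gcongr
  have hlim := tendsto_measure_iInter_atTop (μ := ν)
    (fun n => measurableSet_Ioo.nullMeasurableSet) hanti
    ⟨0, ne_top_of_le_ne_top hfin (measure_mono (Ioo_subset_Ioo_left (hu 0).le))⟩
  have hI : ⋂ n, Ioo (u n) y ⊆ Ico x y := by
    intro z hz
    rw [mem_iInter] at hz
    refine ⟨?_, (hz 0).2⟩
    by_contra! hzx
    obtain ⟨n, hn⟩ := exists_nat_gt ((x - α) / (x - z))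
    have h1 := (hz n).1
    rw [div_lt_iff₀ (sub_pos.2 hzx)] at hn
    have h2 : (x - α) / (n + 2) < x - z := by
      rw [div_lt_iff₀ (by positivity)]
      nlinarith
    simp only [u] at h1
    linarith
  have hle : t * ν (⋂ n, Ioo (u n) y) < M := by
    refine lt_of_le_of_lt ?_ h
    rw [measure_congr (Ioo_ae_eq_Ico (μ := ν) (a := x))]
    gcongr
  obtain ⟨n, hn⟩ := ((ENNReal.Tendsto.const_mul hlim (Or.inr ht)).eventually
    (gt_mem_nhds hle)).exists
  exact ⟨u n, hu n, hux n, hn⟩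

/-- Pointwise domination of the forward maximal function of `ρ` by the local forward maximal
functions of `ν` on the level sets of the `ν`-averages of `ρ`. -/
lemma fwdMax_rpow_le_tsum {ν ρ : Measure ℝ} [NullSingletonClass ν] {p : ℝ} (hp : 0 < p)
    {α β : ℝ} (hfin : ν (Ioo α β) ≠ ∞) (hpos : ∀ x y, x < y → ν (Ioo x y) ≠ 0) {x : ℝ}
    (hx : x ∈ Ioo α β) :
    fwdMax (ρ.restrict (Ioo α β)) x ^ p ≤ ∑' m : ℤ, ((2 : ℝ≥0∞) ^ (m + 1)) ^ p *
      localFwdMax ν p (avgLevel ν ρ (Ioo α β) (2 ^ m)) x := by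
  set T := ∑' m : ℤ, ((2 : ℝ≥0∞) ^ (m + 1)) ^ p *
      localFwdMax ν p (avgLevel ν ρ (Ioo α β) (2 ^ m)) x
  have key : ∀ y, x < y → y ≤ β → (ENNReal.ofReal (y - x))⁻¹ * ρ (Ioo x y) ≤ T ^ p⁻¹ := by
    intro y hxy hyβ
    set s := ν (Ioo x y)
    have hs0 : s ≠ 0 := hpos x y hxy
    have hs_fin : s ≠ ∞ := ne_top_of_le_ne_top hfin (measure_mono (Ioo_subset_Ioo hx.1.le hyβ))
    have hy0 : ENNReal.ofReal (y - x) ≠ 0 := by simpa using hxy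
    set c := (ENNReal.ofReal (y - x))⁻¹ * s
    have hc0 : c ≠ 0 := mul_ne_zero (ENNReal.inv_ne_zero.2 ENNReal.ofReal_ne_top) hs0
    have hctop : c ≠ ∞ := ENNReal.mul_ne_top (ENNReal.inv_ne_top.2 hy0) hs_fin
    have hρ : (ENNReal.ofReal (y - x))⁻¹ * ρ (Ioo x y) = ρ (Ioo x y) / s * c := by
      simp only [c]
      rw [mul_comm _ s, ← mul_assoc, ENNReal.div_mul_cancel hs0 hs_fin, mul_comm]
    rw [hρ, ← ENNReal.le_div_iff_mul_le (Or.inl hc0) (Or.inl hctop)]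
    -- The ratio `ρ (Ioo x y) / s` may be infinite, so the dyadic level is chosen for each `r` below
    -- it.
    refine le_of_forall_lt_imp_le_of_dense fun r hr => ?_
    rw [ENNReal.le_div_iff_mul_le (Or.inl hc0) (Or.inl hctop)]
    by_cases hr0 : r = 0
    · simp [hr0]
    obtain ⟨m, hm, hm'⟩ := ENNReal.exists_mem_Ioc_zpow hr0 hr.ne_top
      (show (1 : ℝ≥0∞) < 2 by norm_num) (by norm_num)
    have h2m : (2 : ℝ≥0∞) ^ m ≠ ∞ := ENNReal.zpow_ne_top (by norm_num) (by norm_num) m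
    have h1 : (2 : ℝ≥0∞) ^ m * s < ρ (Ioo x y) :=
      (ENNReal.lt_div_iff_mul_lt (Or.inl hs0) (Or.inl hs_fin)).1 (hm.trans hr)
    obtain ⟨u, hαu, hux, hu⟩ := exists_lt_mul_measure_Ioo_lt hx.1
      (ne_top_of_le_ne_top hfin (measure_mono (Ioo_subset_Ioo_right hyβ))) h2m h1
    have hsub : Ioo u y ⊆ avgLevel ν ρ (Ioo α β) (2 ^ m) := by
      refine fun z hz => mem_iUnion₂.2 ⟨(u, y), ⟨Ioo_subset_Ioo hαu.le hyβ, ?_⟩, hz⟩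
      exact hu.trans_le (measure_mono (Ioo_subset_Ioo_left hux.le))
    have h2 := rpow_le_localFwdMax ν hp.le (isOpen_avgLevel ν ρ (Ioo α β) (2 ^ m))
      (avgLevel_subset _ _ _ _) (hsub ⟨hux, hxy⟩) hxy
      ((Ioo_subset_Ioo_left hux.le).trans hsub)
    rw [ENNReal.le_rpow_inv_iff hp]
    calc (r * c) ^ p ≤ (2 ^ (m + 1) * c) ^ p := by gcongr
      _ = ((2 : ℝ≥0∞) ^ (m + 1)) ^ p * c ^ p := ENNReal.mul_rpow_of_nonneg _ _ hp.le
      _ ≤ ((2 : ℝ≥0∞) ^ (m + 1)) ^ p *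
          localFwdMax ν p (avgLevel ν ρ (Ioo α β) (2 ^ m)) x := by gcongr
      _ ≤ T := ENNReal.le_tsum (f := fun m : ℤ => ((2 : ℝ≥0∞) ^ (m + 1)) ^ p *
          localFwdMax ν p (avgLevel ν ρ (Ioo α β) (2 ^ m)) x) m
  rw [← ENNReal.le_rpow_inv_iff hp]
  refine iSup₂_le fun h hh => ?_
  -- Cutting at `β` loses no restricted mass and only shortens the interval.
  have hxm : x < min (x + h) β := lt_min (by linarith) hx.2
  refine le_trans ?_ (key (min (x + h) β) hxm (min_le_right _ _))
  rw [Measure.restrict_apply measurableSet_Ioo]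
  have h1 : min (x + h) β - x ≤ h := by linarith [min_le_left (x + h) β]
  gcongr
  exact fun z hz => ⟨hz.1.1, lt_min hz.1.2 hz.2.2⟩

/-- The strong type inequality on an interval of finite dual mass. -/
lemma setLIntegral_fwdMax_rpow_le {p : ℝ} (hp : 1 < p) {w φ : ℝ → ℝ≥0∞} (hw : Measurable w)
    (hw' : ∀ᵐ x, w x < ∞) (hKtop : apPlusConst p w ≠ ∞) (hφ : Measurable φ) {α β : ℝ}
    (hfin : volume.withDensity (dualWeight p w) (Ioo α β) ≠ ∞) :
    ∫⁻ x in Ioo α β, fwdMax ((volume.withDensity φ).restrict (Ioo α β)) x ^ p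
        ∂volume.withDensity w ≤
      ENNReal.ofReal p * 2 ^ p * (apPlusConst p w * aInftyMinusConst (dualWeight p w)) *
        (2 ^ p * 4 * ((1 - (2 : ℝ≥0∞) ^ (-(p - 1)))⁻¹ * 2 ^ (p - 1))) *
          ∫⁻ x, φ x ^ p * w x := by
  set σ := dualWeight p w
  set ν := volume.withDensity σ
  set ρ := volume.withDensity φ
  set ω := volume.withDensity w
  set D := Ioo α β
  set B := ENNReal.ofReal p * 2 ^ p * (apPlusConst p w * aInftyMinusConst σ)
  set C := (1 - (2 : ℝ≥0∞) ^ (-(p - 1)))⁻¹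
  have hp0 : 0 < p := by linarith
  have hp1 : 0 < p - 1 := by linarith
  have hσ : Measurable σ := measurable_dualWeight p hw
  have hpos : ∀ x y, x < y → ν (Ioo x y) ≠ 0 := by
    intro x y hxy h0
    rw [withDensity_apply _ measurableSet_Ioo, lintegral_eq_zero_iff hσ] at h0
    have : ∀ᵐ z ∂volume.restrict (Ioo x y), False := by
      filter_upwards [h0, ae_restrict_of_ae hw'] with z hz hz'
      exact dualWeight_ne_zero hp hz' hz
    rw [Filter.eventually_false_iff_eq_bot, ae_eq_bot, Measure.restrict_eq_zero,
      Real.volume_Ioo] at this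
    simp only [ENNReal.ofReal_eq_zero] at this
    linarith
  let U : ℤ → Set ℝ := fun m => avgLevel ν ρ D (2 ^ m)
  have hUD : ∀ m, U m ⊆ D := fun m => avgLevel_subset _ _ _ _
  have hR : ∀ m, ∫⁻ x, localFwdMax ν p (U m) x ∂ω ≤ B * ν (U m) := fun m => by
    refine lintegral_localFwdMax_le (isOpen_avgLevel _ _ _ _) (hUD m) fun q hq => ?_
    exact testing_fwdMax_dualWeight hp hKtop hq.1
      (ne_top_of_le_ne_top hfin (measure_mono (hq.2.1.trans (hUD m)))) (hpos _ _ hq.1)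
  have h2m : ∀ m : ℤ, (2 : ℝ≥0∞) ^ m ≠ ∞ := fun m =>
    ENNReal.zpow_ne_top (by norm_num) (by norm_num) m
  let Q : ℤ → Set ℝ := fun m => {x | (2 : ℝ≥0∞) ^ m / 2 * σ x < φ x}
  have hQ : ∀ m, MeasurableSet (Q m) := fun m => measurableSet_lt (hσ.const_mul _) hφ
  have hterm : ∀ m : ℤ, ((2 : ℝ≥0∞) ^ (m + 1)) ^ p * ν (U m) ≤
      2 ^ p * 4 * ∫⁻ x in D, (Q m).indicator (fun x => φ x * ((2 : ℝ≥0∞) ^ m) ^ (p - 1)) x := by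
    intro m
    -- One factor `2 ^ m` is spent on the weak type inequality; the power `p - 1` remains for the
    -- sum over `m`.
    have e : ((2 : ℝ≥0∞) ^ (m + 1)) ^ p = 2 ^ p * ((2 : ℝ≥0∞) ^ m) ^ (p - 1) * 2 ^ m := by
      rw [ENNReal.zpow_add (by norm_num) (by norm_num), zpow_one,
        ENNReal.mul_rpow_of_nonneg _ _ hp0.le, mul_comm, mul_assoc]
      congr 1
      conv_rhs => rw [← ENNReal.rpow_one ((2 : ℝ≥0∞) ^ m), ← ENNReal.rpow_mul,
        ← ENNReal.rpow_add_of_nonneg _ _ (by linarith) (by norm_num)]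
      congr 1
      ring
    have hW := mul_measure_avgLevel_le hσ hφ hfin (h2m m)
    have hI : ρ (Q m ∩ D) * ((2 : ℝ≥0∞) ^ m) ^ (p - 1) =
        ∫⁻ x in D, (Q m).indicator (fun x => φ x * ((2 : ℝ≥0∞) ^ m) ^ (p - 1)) x := by
      rw [withDensity_apply _ ((hQ m).inter measurableSet_Ioo), lintegral_indicator (hQ m),
        Measure.restrict_restrict (hQ m), lintegral_mul_const _ hφ]
    rw [← hI, e]
    calc 2 ^ p * ((2 : ℝ≥0∞) ^ m) ^ (p - 1) * 2 ^ m * ν (U m)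
        = 2 ^ p * ((2 : ℝ≥0∞) ^ m) ^ (p - 1) * (2 ^ m * ν (U m)) := by ring
      _ ≤ 2 ^ p * ((2 : ℝ≥0∞) ^ m) ^ (p - 1) * (4 * ρ (Q m ∩ D)) := by gcongr
      _ = _ := by ring
  -- At each point the sum is geometric with threshold `2 φ / σ`, and `σ^(-(p-1)) = w` turns the
  -- result into `φ^p w`.
  have hpt : ∀ᵐ x ∂volume.restrict D,
      ∑' m, (Q m).indicator (fun x => φ x * ((2 : ℝ≥0∞) ^ m) ^ (p - 1)) x ≤
        C * 2 ^ (p - 1) * (φ x ^ p * w x) := by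
    filter_upwards [ae_dualWeight_lt_top hw measurableSet_Ioo hfin,
      ae_restrict_of_ae hw'] with x hx hx'
    have hσ0 : σ x ≠ 0 := dualWeight_ne_zero hp hx'
    have hσw : ((σ x)⁻¹) ^ (p - 1) = w x := by
      rw [← ENNReal.rpow_neg_one, ← ENNReal.rpow_mul]
      simp only [σ, dualWeight]
      rw [← ENNReal.rpow_mul]
      have : -(1 / (p - 1)) * (-1 * (p - 1)) = 1 := by field_simp
      rw [this, ENNReal.rpow_one]
    have hterm : ∀ m : ℤ, (Q m).indicator (fun x => φ x * ((2 : ℝ≥0∞) ^ m) ^ (p - 1)) x =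
        φ x * if (2 : ℝ≥0∞) ^ m < 2 * (φ x * (σ x)⁻¹) then ((2 : ℝ≥0∞) ^ m) ^ (p - 1) else 0 := by
      intro m
      have hiff : x ∈ Q m ↔ (2 : ℝ≥0∞) ^ m < 2 * (φ x * (σ x)⁻¹) := by
        simp only [Q, mem_ofPred_eq]
        rw [← ENNReal.lt_div_iff_mul_lt (Or.inl hσ0) (Or.inl hx.ne),
          ENNReal.div_lt_iff (Or.inl (by norm_num)) (Or.inl (by norm_num)), ← div_eq_mul_inv,
          mul_comm (2 : ℝ≥0∞)]
      by_cases h : x ∈ Q m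
      · rw [indicator_of_mem h, if_pos (hiff.1 h)]
      · rw [indicator_of_notMem h, if_neg (fun h' => h (hiff.2 h')), mul_zero]
    simp_rw [hterm]
    rw [ENNReal.tsum_mul_left]
    calc φ x * _ ≤ φ x * (C * (2 * (φ x * (σ x)⁻¹)) ^ (p - 1)) := by
          gcongr
          exact tsum_zpow_rpow_le hp1 _
      _ = C * 2 ^ (p - 1) * (φ x ^ (1 : ℝ) * φ x ^ (p - 1) * w x) := by
          rw [ENNReal.mul_rpow_of_nonneg _ _ hp1.le, ENNReal.mul_rpow_of_nonneg _ _ hp1.le, hσw,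
            ENNReal.rpow_one]
          ring
      _ = _ := by
          rw [← ENNReal.rpow_add_of_nonneg _ _ (by norm_num) hp1.le]
          simp
  calc ∫⁻ x in D, fwdMax (ρ.restrict D) x ^ p ∂ω
      ≤ ∫⁻ x in D, ∑' m : ℤ, ((2 : ℝ≥0∞) ^ (m + 1)) ^ p * localFwdMax ν p (U m) x ∂ω :=
        setLIntegral_mono' measurableSet_Ioo fun x hx => fwdMax_rpow_le_tsum hp0 hfin hpos hx
    _ ≤ ∫⁻ x, ∑' m : ℤ, ((2 : ℝ≥0∞) ^ (m + 1)) ^ p * localFwdMax ν p (U m) x ∂ω :=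
        setLIntegral_le_lintegral _ _
    _ = ∑' m : ℤ, ((2 : ℝ≥0∞) ^ (m + 1)) ^ p * ∫⁻ x, localFwdMax ν p (U m) x ∂ω := by
        rw [lintegral_tsum fun m => ((measurable_localFwdMax _ _ _).const_mul _).aemeasurable]
        exact tsum_congr fun m => lintegral_const_mul _ (measurable_localFwdMax _ _ _)
    _ ≤ ∑' m : ℤ, B * (2 ^ p * 4 *
          ∫⁻ x in D, (Q m).indicator (fun x => φ x * ((2 : ℝ≥0∞) ^ m) ^ (p - 1)) x) := by
        refine ENNReal.tsum_le_tsum fun m => ?_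
        calc _ ≤ ((2 : ℝ≥0∞) ^ (m + 1)) ^ p * (B * ν (U m)) := by gcongr; exact hR m
          _ = B * (((2 : ℝ≥0∞) ^ (m + 1)) ^ p * ν (U m)) := by ring
          _ ≤ _ := mul_le_mul_right (hterm m) B
    _ = B * (2 ^ p * 4 * ∫⁻ x in D,
          ∑' m, (Q m).indicator (fun x => φ x * ((2 : ℝ≥0∞) ^ m) ^ (p - 1)) x) := by
        rw [ENNReal.tsum_mul_left, ENNReal.tsum_mul_left,
          lintegral_tsum fun m => ((hφ.mul_const _).indicator (hQ m)).aemeasurable]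
    _ ≤ B * (2 ^ p * 4 * ∫⁻ x in D, C * 2 ^ (p - 1) * (φ x ^ p * w x)) := by
        exact mul_le_mul_right (mul_le_mul_right (lintegral_mono_ae hpt) _) _
    _ ≤ B * (2 ^ p * 4 * ∫⁻ x, C * 2 ^ (p - 1) * (φ x ^ p * w x)) := by
        exact mul_le_mul_right (mul_le_mul_right (setLIntegral_le_lintegral _ _) _) _
    _ = _ := by
        rw [lintegral_const_mul (f := fun x => φ x ^ p * w x) _ ((hφ.pow_const p).mul hw)]
        ring

/-! ### From bounded intervals to the whole line -/

lemma setLIntegral_Ioi_fwdMax_rpow_le {ω ρ : Measure ℝ} {p : ℝ} (hp : 0 < p) {α : ℝ} {E : ℝ≥0∞}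
    (h : ∀ β, ∫⁻ x in Ioo α β, fwdMax (ρ.restrict (Ioo α β)) x ^ p ∂ω ≤ E) :
    ∫⁻ x in Ioi α, fwdMax ρ x ^ p ∂ω ≤ E := by
  let H : ℕ → ℝ → ℝ≥0∞ := fun n =>
    (Ioo α n).indicator fun x => fwdMax (ρ.restrict (Ioo α n)) x ^ p
  have hH : ∀ n, Measurable (H n) := fun n =>
    ((measurable_fwdMax _).pow_const p).indicator measurableSet_Ioo
  have hmono : Monotone H := by
    intro m n hmn x
    have hsub : Ioo α (m : ℝ) ⊆ Ioo α n := Ioo_subset_Ioo_right (by exact_mod_cast hmn)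
    by_cases hx : x ∈ Ioo α (m : ℝ)
    · simp only [H, indicator_of_mem hx, indicator_of_mem (hsub hx), fwdMax]
      gcongr
    · simp only [H, indicator_of_notMem hx, zero_le]
  have hpt : ∀ x ∈ Ioi α, fwdMax ρ x ^ p ≤ ⨆ n, H n x := by
    intro x hx
    rw [← ENNReal.le_rpow_inv_iff hp]
    refine iSup₂_le fun h hh => ?_
    obtain ⟨n, hn⟩ := exists_nat_gt (x + h)
    have hxn : x ∈ Ioo α (n : ℝ) := ⟨hx, by linarith⟩
    rw [ENNReal.le_rpow_inv_iff hp]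
    refine le_trans ?_ (le_iSup (fun n => H n x) n)
    simp only [H, indicator_of_mem hxn]
    gcongr
    refine le_trans (le_of_eq ?_) (le_fwdMax _ (show x < x + h by linarith))
    rw [Measure.restrict_apply measurableSet_Ioo,
      inter_eq_self_of_subset_left (Ioo_subset_Ioo (le_of_lt hx) hn.le), add_sub_cancel_left]
  calc ∫⁻ x in Ioi α, fwdMax ρ x ^ p ∂ω ≤ ∫⁻ x in Ioi α, ⨆ n, H n x ∂ω :=
        setLIntegral_mono' measurableSet_Ioi hpt
    _ ≤ ∫⁻ x, ⨆ n, H n x ∂ω := setLIntegral_le_lintegral _ _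
    _ = ⨆ n, ∫⁻ x, H n x ∂ω := lintegral_iSup hH hmono
    _ ≤ E := iSup_le fun n => by
        simp only [H]
        rw [lintegral_indicator measurableSet_Ioo]
        exact h n

/-- The weight vanishes to the left of any interval of infinite dual mass. -/
lemma ApPlusBound.measure_Iio_eq_zero {p : ℝ} (hp : 1 < p) {K : ℝ≥0∞} {ω ν : Measure ℝ}
    (hK : ApPlusBound p K ω ν) (hKtop : K ≠ ∞) {r β : ℝ} (h : ν (Ioo r β) = ∞) :
    ω (Iio r) = 0 := by
  have hrβ : r < β := by
    by_contra! hle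
    simp [Ioo_eq_empty_of_le hle] at h
  have hU : Iio r ⊆ ⋃ n : ℕ, Ioo (r - (n + 1)) r := by
    intro x hx
    obtain ⟨n, hn⟩ := exists_nat_gt (r - x)
    exact mem_iUnion.2 ⟨n, by linarith, hx⟩
  refine measure_mono_null hU (measure_iUnion_null fun n => ?_)
  have hn : r - ((n : ℝ) + 1) < r := by linarith [n.cast_nonneg (α := ℝ)]
  -- With infinite dual mass on the right, a finite product forces the left factor to vanish.
  have h1 := hK _ r β hn hrβ
  have hi : (ENNReal.ofReal (β - (r - ((n : ℝ) + 1))))⁻¹ ≠ 0 :=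
    ENNReal.inv_ne_zero.2 ENNReal.ofReal_ne_top
  rw [h, ENNReal.mul_top hi, ENNReal.top_rpow_of_pos (by linarith)] at h1
  by_contra h0
  rw [ENNReal.mul_top (mul_ne_zero hi h0)] at h1
  exact hKtop (top_le_iff.1 h1)

/-- A rational `r` is good if all bounded intervals starting at it have finite `ν`-mass. Good rays
`(r, ∞)` increase to `V`; to the left of bad rationals `ω` vanishes. Two points in neither region
would be separated by a rational of one kind, so at most one null point is left. -/
lemma ApPlusBound.lintegral_fwdMax_rpow_le {p : ℝ} (hp : 1 < p) {K : ℝ≥0∞} {ω ν ρ : Measure ℝ}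
    [NullSingletonClass ω] (hK : ApPlusBound p K ω ν) (hKtop : K ≠ ∞) {E : ℝ≥0∞}
    (h : ∀ α β, ν (Ioo α β) ≠ ∞ →
      ∫⁻ x in Ioo α β, fwdMax (ρ.restrict (Ioo α β)) x ^ p ∂ω ≤ E) :
    ∫⁻ x, fwdMax ρ x ^ p ∂ω ≤ E := by
  let G : Set ℚ := {r | ∀ β, ν (Ioo (r : ℝ) β) ≠ ∞}
  let V : Set ℝ := ⋃ r : G, Ioi ((r : ℚ) : ℝ)
  have hnull : ω Vᶜ = 0 := by
    have hZ : ω (⋃ r : (Gᶜ : Set ℚ), Iio ((r : ℚ) : ℝ)) = 0 := by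
      refine measure_iUnion_null fun r => ?_
      obtain ⟨β, hβ⟩ : ∃ β, ν (Ioo ((r : ℚ) : ℝ) β) = ∞ := by
        by_contra! hcon
        exact r.2 hcon
      exact hK.measure_Iio_eq_zero hp hKtop hβ
    have hsub : (Vᶜ \ ⋃ r : (Gᶜ : Set ℚ), Iio ((r : ℚ) : ℝ)).Subsingleton := by
      have key : ∀ x ∈ Vᶜ \ ⋃ r : (Gᶜ : Set ℚ), Iio ((r : ℚ) : ℝ),
          ∀ y ∈ Vᶜ \ ⋃ r : (Gᶜ : Set ℚ), Iio ((r : ℚ) : ℝ), y ≤ x := by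
        intro x hx y hy
        by_contra! hxy
        obtain ⟨r, hr, hr'⟩ := exists_rat_btwn hxy
        by_cases hrG : r ∈ G
        · exact hy.1 (mem_iUnion.2 ⟨⟨r, hrG⟩, hr'⟩)
        · exact hx.2 (mem_iUnion.2 ⟨⟨r, hrG⟩, hr⟩)
      exact fun x hx y hy => le_antisymm (key y hy x hx) (key x hx y hy)
    refine measure_mono_null (fun x hx => ?_) (measure_union_null hZ (hsub.measure_zero ω))
    by_cases hxZ : x ∈ ⋃ r : (Gᶜ : Set ℚ), Iio ((r : ℚ) : ℝ)
    · exact Or.inl hxZ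
    · exact Or.inr ⟨hx, hxZ⟩
  have hV : ω.restrict V = ω := Measure.restrict_eq_self_of_ae_mem (by
    rw [ae_iff]; exact hnull)
  have hdir : Directed (· ⊆ ·) fun r : G => Ioi ((r : ℚ) : ℝ) := by
    intro r s
    rcases le_total (r : ℚ) s with hrs | hrs
    · exact ⟨r, subset_rfl, Ioi_subset_Ioi (by exact_mod_cast hrs)⟩
    · exact ⟨s, Ioi_subset_Ioi (by exact_mod_cast hrs), subset_rfl⟩
  rw [← hV, setLIntegral_iUnion_of_directed _ hdir]
  exact iSup_le fun r => setLIntegral_Ioi_fwdMax_rpow_le (by linarith) fun β => h _ _ (r.2 β)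

/-! ### Constants and conclusion -/

/-- The constant in the strong type inequality. -/
noncomputable def strongConst (p : ℝ) : ℝ≥0∞ :=
  ENNReal.ofReal p * 2 ^ p * (2 ^ p * 4 * ((1 - (2 : ℝ≥0∞) ^ (-(p - 1)))⁻¹ * 2 ^ (p - 1)))

lemma strongConst_ne_top {p : ℝ} (hp : 1 < p) : strongConst p ≠ ∞ := by
  have h1 : (2 : ℝ≥0∞) ^ (-(p - 1)) < 1 :=
    ENNReal.rpow_lt_one_of_one_lt_of_neg (by norm_num) (by linarith)
  have h2 : (1 - (2 : ℝ≥0∞) ^ (-(p - 1)))⁻¹ ≠ ∞ := ENNReal.inv_ne_top.2 (tsub_pos_of_lt h1).ne'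
  have h3 : (2 : ℝ≥0∞) ^ p ≠ ∞ := by simp
  have h4 : (2 : ℝ≥0∞) ^ (p - 1) ≠ ∞ := by simp
  exact ENNReal.mul_ne_top (ENNReal.mul_ne_top ENNReal.ofReal_ne_top h3)
    (ENNReal.mul_ne_top (ENNReal.mul_ne_top h3 (by norm_num)) (ENNReal.mul_ne_top h2 h4))

lemma maximalPlus_congr_ae {E : Type*} [ENorm E] {f g : ℝ → E} (h : f =ᵐ[volume] g) :
    maximalPlus f = maximalPlus g := by
  have h' : (fun y => ‖f y‖ₑ) =ᵐ[volume] fun y => ‖g y‖ₑ := h.fun_comp fun t => ‖t‖ₑ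
  rw [maximalPlus_eq_fwdMax, maximalPlus_eq_fwdMax, withDensity_congr_ae h']

lemma weightedNorm_congr_ae {E : Type*} [ENorm E] (p : ℝ) {w w' : ℝ → ℝ≥0∞} {f g : ℝ → E}
    (hw : w =ᵐ[volume] w') (h : f =ᵐ[volume] g) : weightedNorm p w f = weightedNorm p w' g := by
  unfold weightedNorm
  congr 1
  refine lintegral_congr_ae ?_
  filter_upwards [hw, h] with x h1 h2
  rw [h1, h2]

lemma dualWeight_congr_ae (p : ℝ) {w w' : ℝ → ℝ≥0∞} (hw : w =ᵐ[volume] w') :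
    dualWeight p w =ᵐ[volume] dualWeight p w' :=
  hw.mono fun x hx => by simp only [dualWeight, hx]

lemma apPlusConst_congr_ae (p : ℝ) {w w' : ℝ → ℝ≥0∞} (hw : w =ᵐ[volume] w') :
    apPlusConst p w = apPlusConst p w' := by
  unfold apPlusConst
  simp only [fun s : Set ℝ => lintegral_congr_ae (ae_restrict_of_ae (s := s) hw),
    fun s : Set ℝ => lintegral_congr_ae (ae_restrict_of_ae (s := s) (dualWeight_congr_ae p hw))]

lemma aInftyMinusConst_congr_ae {v v' : ℝ → ℝ≥0∞} (hv : v =ᵐ[volume] v') :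
    aInftyMinusConst v = aInftyMinusConst v' := by
  have h : ∀ a b : ℝ, maximalPlus ((Ioo a b).indicator v) = maximalPlus ((Ioo a b).indicator v') :=
    fun a b => maximalPlus_congr_ae (hv.indicator)
  unfold aInftyMinusConst
  simp only [h, fun s : Set ℝ => lintegral_congr_ae (ae_restrict_of_ae (s := s) hv)]

/-- The mixed bound with explicit constant. -/
lemma weightedNorm_maximalPlus_le {p : ℝ} (hp : 1 < p) {w : ℝ → ℝ≥0∞} (hw : MemApPlus p w)
    {f : ℝ → ℝ} (hf : AEMeasurable f volume) :
    weightedNorm p w (maximalPlus f) ≤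
      strongConst p ^ (1 / p) *
        (apPlusConst p w * aInftyMinusConst (dualWeight p w)) ^ (1 / p) * weightedNorm p w f := by
  -- Every quantity involved depends only on almost everywhere classes, so Borel representatives
  -- suffice.
  wlog h : Measurable w ∧ Measurable f generalizing w f
  · have ew := hw.1.aemeasurable.ae_eq_mk
    have ef := hf.ae_eq_mk
    have hw' : MemApPlus p (hw.1.aemeasurable.mk w) := by
      refine ⟨⟨hw.1.aemeasurable.measurable_mk.aemeasurable, ?_⟩, ?_⟩
      · filter_upwards [ew, hw.1.ae_lt_top] with x h1 h2
        rwa [← h1]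
      · rw [← apPlusConst_congr_ae p ew]
        exact hw.2
    have := this hw' hf.measurable_mk.aemeasurable
      ⟨hw.1.aemeasurable.measurable_mk, hf.measurable_mk⟩
    rwa [← apPlusConst_congr_ae p ew, ← aInftyMinusConst_congr_ae (dualWeight_congr_ae p ew),
      ← maximalPlus_congr_ae ef, ← weightedNorm_congr_ae p ew ef,
      ← weightedNorm_congr_ae p ew (Filter.EventuallyEq.refl _ _)] at this
  obtain ⟨hwm, hfm⟩ := h
  have hp0 : 0 < p := by linarith
  have hφ : Measurable fun y => ‖f y‖ₑ := hfm.enorm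
  have h1 : ∫⁻ x, maximalPlus f x ^ p * w x ≤ strongConst p *
      (apPlusConst p w * aInftyMinusConst (dualWeight p w)) * ∫⁻ x, ‖f x‖ₑ ^ p * w x := by
    rw [maximalPlus_eq_fwdMax]
    have h2 := (apPlusBound_apPlusConst p w).lintegral_fwdMax_rpow_le hp hw.2.ne
      fun α β hfin => setLIntegral_fwdMax_rpow_le hp hwm hw.1.ae_lt_top hw.2.ne hφ hfin
    rw [lintegral_withDensity_eq_lintegral_mul _ hwm ((measurable_fwdMax _).pow_const p)] at h2
    simp only [Pi.mul_apply, mul_comm (w _)] at h2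
    refine h2.trans (le_of_eq ?_)
    simp only [strongConst]
    ring
  unfold weightedNorm
  simp only [enorm_eq_self]
  rw [← ENNReal.mul_rpow_of_nonneg _ _ (by positivity),
    ← ENNReal.mul_rpow_of_nonneg _ _ (by positivity)]
  exact ENNReal.rpow_le_rpow h1 (by positivity)

/-- Inserting the bound for the `A_∞^-` constant gives `K * K^(1/(p-1)) = K^(p/(p-1))`, whose `1/p`
power is `K^(1/(p-1))`. -/
lemma apPlusConst_mul_aInftyMinusConst_rpow_le {p : ℝ} (hp : 1 < p) {w : ℝ → ℝ≥0∞}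
    (hw : MemApPlus p w) :
    (apPlusConst p w * aInftyMinusConst (dualWeight p w)) ^ (1 / p) ≤
      ((ENNReal.ofReal p * 2 ^ p) ^ (1 / (p - 1))) ^ (1 / p) *
        apPlusConst p w ^ (1 / (p - 1)) := by
  wlog h : Measurable w generalizing w
  · have ew := hw.1.aemeasurable.ae_eq_mk
    have hw' : MemApPlus p (hw.1.aemeasurable.mk w) := by
      refine ⟨⟨hw.1.aemeasurable.measurable_mk.aemeasurable, ?_⟩, ?_⟩
      · filter_upwards [ew, hw.1.ae_lt_top] with x h1 h2
        rwa [← h1]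
      · rw [← apPlusConst_congr_ae p ew]
        exact hw.2
    have := this hw' hw.1.aemeasurable.measurable_mk
    rwa [← apPlusConst_congr_ae p ew, ← aInftyMinusConst_congr_ae (dualWeight_congr_ae p ew)]
      at this
  have hp0 : 0 < p := by linarith
  have hp1 : 0 < p - 1 := by linarith
  have h1 := aInftyMinusConst_dualWeight_le hp h hw.1.ae_lt_top hw.2.ne
  rw [← mul_assoc, ENNReal.mul_rpow_of_nonneg _ _ (by positivity)] at h1
  set K := apPlusConst p w
  set d := (ENNReal.ofReal p * 2 ^ p) ^ (1 / (p - 1))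
  calc (K * aInftyMinusConst (dualWeight p w)) ^ (1 / p)
      ≤ (K * (d * K ^ (1 / (p - 1)))) ^ (1 / p) := by gcongr
    _ = (d * (K ^ (1 : ℝ) * K ^ (1 / (p - 1)))) ^ (1 / p) := by
        rw [ENNReal.rpow_one]; congr 1; ring
    _ = (d * K ^ (p / (p - 1))) ^ (1 / p) := by
        rw [← ENNReal.rpow_add_of_nonneg _ _ (by norm_num) (by positivity)]
        congr 3
        field_simp
        ring
    _ = _ := by
        rw [ENNReal.mul_rpow_of_nonneg _ _ (by positivity), ← ENNReal.rpow_mul K]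
        have : p / (p - 1) * (1 / p) = 1 / (p - 1) := by field_simp
        rw [this]

theorem theorem1 (p : ℝ) (hp : 1 < p) :
    ∃ c : ℝ≥0, ∀ w : ℝ → ℝ≥0∞, MemApPlus p w →
      ∀ f : ℝ → ℝ, AEMeasurable f volume →
        weightedNorm p w (maximalPlus f) ≤
            c * apPlusConst p w ^ (1 / (p - 1)) * weightedNorm p w f ∧
          weightedNorm p w (maximalPlus f) ≤
            c * (apPlusConst p w * aInftyMinusConst (dualWeight p w)) ^ (1 / p) *
              weightedNorm p w f := by
  set c₁ := strongConst p ^ (1 / p)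
  set c₂ := ((ENNReal.ofReal p * 2 ^ p) ^ (1 / (p - 1))) ^ (1 / p)
  have hp0 : 0 ≤ 1 / p := by positivity
  have hp1 : 0 ≤ 1 / (p - 1) := one_div_nonneg.2 (by linarith)
  have h1 : c₁ ≠ ∞ := ENNReal.rpow_ne_top_of_nonneg hp0 (strongConst_ne_top hp)
  have h2 : c₂ ≠ ∞ := ENNReal.rpow_ne_top_of_nonneg hp0 <| ENNReal.rpow_ne_top_of_nonneg hp1 <|
    ENNReal.mul_ne_top ENNReal.ofReal_ne_top (by simp)
  have h3 : max c₁ (c₁ * c₂) ≠ ∞ := (max_lt h1.lt_top (ENNReal.mul_lt_top h1.lt_top h2.lt_top)).ne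
  refine ⟨(max c₁ (c₁ * c₂)).toNNReal, fun w hw f hf => ?_⟩
  rw [ENNReal.coe_toNNReal h3]
  have h4 := weightedNorm_maximalPlus_le hp hw hf
  constructor
  · calc _ ≤ _ := h4
      _ ≤ c₁ * (c₂ * apPlusConst p w ^ (1 / (p - 1))) * weightedNorm p w f := by
          gcongr
          exact apPlusConst_mul_aInftyMinusConst_rpow_le hp hw
      _ = c₁ * c₂ * apPlusConst p w ^ (1 / (p - 1)) * weightedNorm p w f := by ring
      _ ≤ _ := by
          gcongr
          exact le_max_right _ _
  · refine h4.trans ?_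
    gcongr
    exact le_max_left _ _
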